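/- For an odd integer $t\ge 3$, a $t$-Schur overpartition of an integer $N\ge 0$ is a partition of $N$ all of whose parts are congruent modulo $2t$ to an element of $\{1,3,5,\dots,2t-1\}\setminus\{t\}$, in which the first occurrence of each distinct part may be overlined. Let $\overline{S}_t(N)$ denote the number of $t$-Schur overpartitions of $N$ and, for $r\ge 1$, let $\overline{S}_t^{\,r}(N)$ denote the number of $r$-tuples of $t$-Schur overpartitions whose sizes add up to $N$; equivalently, $$\sum_{N\ge 0}\overline{S}_t^{\,r}(N)q^N=\prod_{k\ge 1}\frac{(1+q^{2k-1})^r(1-q^{t(2k-1)})^r}{(1+q^{t(2k-1)})^r(1-q^{2k-1})^r},\qquad \overline{S}_t=\overline{S}_t^{\,1}.$$ **Theorem.** Let $p$ be a prime with $p\equiv 5\pmod 6$, let $\alpha, n, m\ge 0$ be integers, and let $i$ be an integer with $1\le i\le p-1$. Then $$\overline{S}_3\left(24p^{2\alpha+2}n+(24i+7p)p^{2\alpha+1}\right)\equiv 0\pmod{32}$$ and $$\overline{S}_3^{\,16m+1}\left(24p^{2\alpha+2}n+(24i+19p)p^{2\alpha+1}\right)\equiv 0\pmod{32}.$$ -/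

import Mathlib

/-- The admissible residues modulo `2t` of the parts of a `t`-Schur overpartition:
`{1, 3, 5, …, 2t - 1} \ {t}`. -/
def schurResidues (t : ℕ) : Finset ℕ :=
  {i ∈ Finset.range (2 * t) | Odd i ∧ i ≠ t}

/-- A `t`-Schur overpartition of `n`: a partition of `n` all of whose parts are congruent
modulo `2t` to an element of `schurResidues t`, in which, for each part size that occurs,
the first occurrence of that part may be overlined. The overlining is recorded by the set
of those part sizes whose first occurrence is overlined. -/
@[ext]
structure SchurOverpartition (t n : ℕ) where
  /-- the underlying partition -/
  partition : n.Partition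
  /-- every part has an admissible residue -/
  residue_mem : ∀ i ∈ partition.parts, i % (2 * t) ∈ schurResidues t
  /-- the part sizes whose first occurrence is overlined -/
  overlined : Finset ℕ
  /-- only parts that occur can be overlined -/
  overlined_subset : overlined ⊆ partition.parts.toFinset

/-- There are finitely many `t`-Schur overpartitions of `n`. -/
instance SchurOverpartition.instFinite (t n : ℕ) : Finite (SchurOverpartition t n) := by
  let f : SchurOverpartition t n →
      Σ p : n.Partition, {s : Finset ℕ // s ∈ p.parts.toFinset.powerset} :=
    fun P => ⟨P.partition, P.overlined, Finset.mem_powerset.mpr P.overlined_subset⟩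
  refine Finite.of_injective f ?_
  rintro ⟨p, hp, s, hs⟩ ⟨p', hp', s', hs'⟩ h
  simp only [f, Sigma.mk.injEq] at h
  obtain ⟨rfl, h⟩ := h
  simpa using h

/-- The number of `t`-Schur overpartitions of `n`. -/
noncomputable def schurOverpartitionCount (t n : ℕ) : ℕ :=
  Nat.card (SchurOverpartition t n)

/-- An `r`-tuple of `t`-Schur overpartitions of total size `n`: sizes `s 0, …, s (r - 1)` with
sum `n`, together with a `t`-Schur overpartition of `s j` for each index `j`. -/
abbrev SchurOverpartitionTuple (t r n : ℕ) : Type :=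
  Σ s : {s : Fin r → ℕ // s ∈ Finset.finAntidiagonal r n},
    ∀ j : Fin r, SchurOverpartition t (s.1 j)

/-- The number of `r`-tuples of `t`-Schur overpartitions of total size `n`. -/
noncomputable def schurOverpartitionTupleCount (t r n : ℕ) : ℕ :=
  Nat.card (SchurOverpartitionTuple t r n)

/-! Let `F` be the generating function. The product formula amounts to `F(q) φ(-q) φ(-q^6) = φ(-q^2)
φ(-q^3)`, where φ and ψ are Ramanujan's theta functions. Write `f_k = ∏ (1 - q^(kn))`. Since `φ(q)
φ(-q) = φ(-q^2)^2`, also `F(q) φ(-q^2) φ(-q^6) = φ(q) φ(-q^3)`. Taking odd parts twice and then the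
exponents `≡ 1` mod 3 isolates the coefficients at `12n + 7`. Their series is `8K`, where modulo 4
one has `K ≡ ψ(q^2) f_4^2 φ(-q)` (`exists_dissect_twelve_seven_eq`).

Splitting `φ(-q) = φ(q^4) - 2q ψ(q^8)` gives the even part of `K` as `ψ(q) f_4` and the odd part as
`-2 ψ(q) f_16`, both modulo 4. By the pentagonal number theorem these are sparse: a nonzero
coefficient at `q^M` represents `24M + 7`, respectively `24M + 19`, by the form `3x^2 + y^2`. For a
prime `p ≡ 5` mod 6, `-3` is not a square modulo `p`, so `p` divides no nonzero value of this form
to an odd power. The arguments in the theorem are divisible by `p` to exactly an odd power, hence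
the factor `8 · 4 = 32`. For tuples, `F ≡ 1` mod 2 gives `F^16 ≡ 1` mod 32.

Most of the theta identities are changes of variables on `ℤ × ℤ`. Gauss's product for `φ(-q)` comes
from a telescoping finite sum, and two further identities from the rigidity of series under `q ↦
q^2`. -/

open PowerSeries

namespace ThetaSeries

/-! ### Dissection of power series -/

/-- The power series whose `n`-th coefficient is the `(k * n + r)`-th coefficient of `f`. -/
noncomputable def dissect {R : Type*} [CommRing R] (k r : ℕ) : R⟦X⟧ →ₗ[R] R⟦X⟧ where
  toFun f := PowerSeries.mk fun n => coeff (k * n + r) f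
  map_add' f g := by ext n; simp
  map_smul' c f := by ext n; simp

@[simp]
theorem coeff_dissect {R : Type*} [CommRing R] (k r n : ℕ) (f : R⟦X⟧) :
    coeff n (dissect k r f) = coeff (k * n + r) f := by
  simp [dissect]

/-- A factor in `q^k` does not change residues of exponents modulo `k`, so it passes through the
dissection. This is how denominators in `q^k` are handled throughout. -/
theorem dissect_mul_expand {R : Type*} [CommRing R] {k r : ℕ} (hk : k ≠ 0) (hr : r < k)
    (f g : R⟦X⟧) : dissect k r (f * expand k hk g) = dissect k r f * g := by
  have hk' : 0 < k := Nat.pos_of_ne_zero hk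
  ext n
  rw [coeff_dissect, coeff_mul, coeff_mul]
  symm
  refine Finset.sum_of_injOn (fun x => (k * x.1 + r, k * x.2)) ?_ ?_ ?_ ?_
  · rintro ⟨a, b⟩ - ⟨c, d⟩ - h
    simp only [Prod.mk.injEq, Nat.add_right_cancel_iff] at h
    exact Prod.ext (Nat.eq_of_mul_eq_mul_left hk' h.1) (Nat.eq_of_mul_eq_mul_left hk' h.2)
  · rintro ⟨a, b⟩ h
    simp only [Finset.mem_coe,
      Finset.HasAntidiagonal.mem_antidiagonal] at h ⊢
    rw [← h]; ring
  · rintro ⟨a, b⟩ h hn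
    rw [Finset.HasAntidiagonal.mem_antidiagonal] at h
    simp only at h ⊢
    rw [coeff_expand]
    split_ifs with hd
    · exfalso
      obtain ⟨c, rfl⟩ := hd
      have hcn : c ≤ n := by
        by_contra hlt
        have : k * (n + 1) ≤ k * c := Nat.mul_le_mul_left k (by omega)
        rw [mul_add] at this
        omega
      refine hn ⟨(n - c, c), by simp [hcn], ?_⟩
      have : k * n = k * (n - c) + k * c := by rw [← mul_add, Nat.sub_add_cancel hcn]
      simp only [Prod.mk.injEq, and_true]
      omega
    · simp
  · rintro ⟨a, b⟩ -
    simp only [coeff_dissect, coeff_expand_mul]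

theorem dissect_expand_mul {R : Type*} [CommRing R] {k r : ℕ} (hk : k ≠ 0) (hr : r < k)
    (f g : R⟦X⟧) : dissect k r (expand k hk g * f) = g * dissect k r f := by
  rw [mul_comm, dissect_mul_expand hk hr, mul_comm]

theorem dissect_X_pow_mul_expand {R : Type*} [CommRing R] {k r s : ℕ} (hk : k ≠ 0) (hr : r < k)
    (hs : s < k) (g : R⟦X⟧) :
    dissect k r (X ^ s * expand k hk g) = if s = r then g else 0 := by
  rw [dissect_mul_expand hk hr]
  have : dissect k r (X ^ s : R⟦X⟧) = if s = r then 1 else 0 := by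
    ext n
    rw [coeff_dissect, coeff_X_pow]
    split_ifs with h1 h2 h2
    · have : n = 0 := by
        rcases Nat.eq_zero_or_pos n with h | h
        · exact h
        · have : k * 1 ≤ k * n := Nat.mul_le_mul_left k h
          omega
      simp [this]
    · exfalso
      rcases Nat.eq_zero_or_pos n with h | h
      · subst h; simp at h1; omega
      · have : k * 1 ≤ k * n := Nat.mul_le_mul_left k h
        omega
    · rw [coeff_one, if_neg]
      rintro rfl
      simp at h1; omega
    · simp
  rw [this]
  split_ifs <;> simp

theorem eq_expand_add_expand {R : Type*} [CommRing R] (f : R⟦X⟧) :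
    f = expand 2 two_ne_zero (dissect 2 0 f) + X * expand 2 two_ne_zero (dissect 2 1 f) := by
  ext n
  rcases Nat.even_or_odd' n with ⟨m, rfl | rfl⟩
  · rw [map_add, coeff_expand_mul]
    rcases m with _ | m
    · simp
    · rw [show 2 * (m + 1) = (2 * m + 1) + 1 by ring, coeff_succ_X_mul,
        coeff_expand_of_not_dvd _ _ _ (by omega)]
      simp [mul_add]
  · rw [map_add, coeff_succ_X_mul, coeff_expand_mul, coeff_expand_of_not_dvd _ _ _ (by omega)]
    simp

theorem expand_comp {R : Type*} [CommRing R] {k l m : ℕ} (hk : k ≠ 0) (hl : l ≠ 0) (hm : m ≠ 0)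
    (h : k * l = m) (f : R⟦X⟧) : expand k hk (expand l hl f) = expand m hm f := by
  subst h
  exact (expand_mul k hk l hl f).symm

/-! ### Series indexed by lattices -/

variable {ι κ : Type*}

/-- The formal series `∑ i, w i * X ^ e i`. -/
noncomputable def series (e : ι → ℕ) (w : ι → ℤ) : ℤ⟦X⟧ :=
  PowerSeries.mk fun n => ∑ᶠ i ∈ e ⁻¹' {n}, w i

theorem coeff_series (e : ι → ℕ) (w : ι → ℤ) (n : ℕ) :
    coeff n (series e w) = ∑ᶠ i ∈ e ⁻¹' {n}, w i := by
  simp [series]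

/-- Every exponent is taken finitely often. -/
def FiniteFibers (e : ι → ℕ) : Prop := ∀ n, (e ⁻¹' {n}).Finite

theorem coeff_series_eq_zero {e : ι → ℕ} {w : ι → ℤ} {n : ℕ} (h : ∀ i, e i ≠ n) :
    coeff n (series e w) = 0 := by
  rw [coeff_series]
  apply finsum_mem_eq_zero_of_forall_eq_zero
  intro i hi
  exact absurd hi (h i)

theorem coeff_series_eq_sum {e : ι → ℕ} (w : ι → ℤ) (he : FiniteFibers e) (n : ℕ) :
    coeff n (series e w) = ∑ i ∈ (he n).toFinset, w i := by
  rw [coeff_series]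
  exact finsum_mem_eq_finite_toFinset_sum _ (he n)

/-- Finite fibers matter: `finsum` takes the default value 0 on infinite support, which would break
the product formula. -/
theorem series_mul {e : ι → ℕ} {e' : κ → ℕ} (w : ι → ℤ) (w' : κ → ℤ) (he : FiniteFibers e)
    (he' : FiniteFibers e') :
    series e w * series e' w' =
      series (fun x : ι × κ => e x.1 + e' x.2) (fun x => w x.1 * w' x.2) := by
  classical
  ext n
  have hfin : ((fun x : ι × κ => e x.1 + e' x.2) ⁻¹' {n}) =
      ↑((Finset.HasAntidiagonal.antidiagonal n).biUnion fun p =>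
        (he p.1).toFinset ×ˢ (he' p.2).toFinset) := by
    ext ⟨a, b⟩
    simp
  rw [coeff_mul, coeff_series, hfin, finsum_mem_coe_finset, Finset.sum_biUnion]
  · refine Finset.sum_congr rfl fun p _ => ?_
    rw [coeff_series_eq_sum w he, coeff_series_eq_sum w' he', Finset.sum_product,
      Finset.sum_mul_sum]
  · rintro ⟨a, b⟩ - ⟨c, d⟩ - hne
    rw [Function.onFun, Finset.disjoint_left]
    rintro ⟨x, y⟩ h1 h2
    simp at h1 h2
    exact hne (by simp [← h1.1, ← h1.2, ← h2.1, ← h2.2])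

theorem expand_series {k : ℕ} (hk : k ≠ 0) (e : ι → ℕ) (w : ι → ℤ) :
    expand k hk (series e w) = series (fun i => k * e i) w := by
  ext n
  rw [coeff_expand]
  split_ifs with h
  · obtain ⟨m, rfl⟩ := h
    rw [Nat.mul_div_cancel_left _ (Nat.pos_of_ne_zero hk), coeff_series, coeff_series]
    congr! 3 with i
    simp [hk]
  · rw [coeff_series_eq_zero]
    rintro i rfl
    exact h ⟨_, rfl⟩

theorem FiniteFibers.const_mul {e : ι → ℕ} (he : FiniteFibers e) {k : ℕ} (hk : k ≠ 0) :
    FiniteFibers fun i => k * e i := by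
  intro n
  refine (he (n / k)).subset ?_
  rintro i rfl
  simp [Nat.pos_of_ne_zero hk]

/-- Dissection of a lattice series by a parametrization of the terms that survive. -/
theorem dissect_series {e : ι → ℕ} {w : ι → ℤ} {e' : κ → ℕ} {w' : κ → ℤ} (k r : ℕ) (hr : r < k)
    (g : κ → ι) (hg : Function.Injective g) (he : ∀ j, e (g j) = k * e' j + r)
    (hw : ∀ j, w (g j) = w' j) (hsurj : ∀ i, e i % k = r → ∃ j, g j = i) :
    dissect k r (series e w) = series e' w' := by
  ext n
  rw [coeff_dissect, coeff_series, coeff_series]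
  symm
  refine finsum_mem_eq_of_bijOn g ⟨?_, hg.injOn, ?_⟩ fun j _ => (hw j).symm
  · rintro j rfl
    simp [he]
  · intro i hi
    obtain ⟨j, rfl⟩ := hsurj i (by
      rw [Set.mem_preimage, Set.mem_singleton_iff] at hi
      rw [hi, Nat.mul_add_mod, Nat.mod_eq_of_lt hr])
    refine ⟨j, ?_, rfl⟩
    simp only [Set.mem_preimage, he, Set.mem_singleton_iff, Nat.add_right_cancel_iff] at hi ⊢
    exact Nat.eq_of_mul_eq_mul_left (by omega) hi

theorem series_reindex {e : ι → ℕ} {w : ι → ℤ} {e' : κ → ℕ} {w' : κ → ℤ}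
    (g : κ → ι) (hg : Function.Bijective g) (he : ∀ j, e (g j) = e' j)
    (hw : ∀ j, w (g j) = w' j) : series e w = series e' w' := by
  have := dissect_series 1 0 one_pos g hg.1 (by simpa using he) hw fun i _ => hg.2 i
  rw [← this]
  ext n
  simp

theorem series_sum {e : ι → ℕ} {e' : κ → ℕ} (w : ι → ℤ) (w' : κ → ℤ) (he : FiniteFibers e)
    (he' : FiniteFibers e') :
    series (Sum.elim e e') (Sum.elim w w') = series e w + series e' w' := by
  classical
  ext n
  have hset : (Sum.elim e e') ⁻¹' {n} = ↑((he n).toFinset.disjSum (he' n).toFinset) := by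
    ext x
    rcases x with x | x <;> simp
  rw [map_add, coeff_series, hset, finsum_mem_coe_finset, Finset.sum_disjSum,
    coeff_series_eq_sum w he, coeff_series_eq_sum w' he']
  rfl

theorem series_add {e : ι → ℕ} (w w' : ι → ℤ) (he : FiniteFibers e) :
    series e w + series e w' = series e (fun i => w i + w' i) := by
  ext n
  rw [map_add, coeff_series_eq_sum _ he, coeff_series_eq_sum _ he, coeff_series_eq_sum _ he,
    Finset.sum_add_distrib]

theorem X_pow_mul_series (s : ℕ) (e : ι → ℕ) (w : ι → ℤ) :
    X ^ s * series e w = series (fun i => e i + s) w := by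
  ext n
  rw [coeff_X_pow_mul']
  split_ifs with h
  · rw [coeff_series, coeff_series]
    congr! 3 with i
    simp
    omega
  · rw [coeff_series_eq_zero]
    intro i
    omega

/-- Terms that an exponent preserving permutation pairs with opposite signs cancel. -/
theorem coeff_series_eq_zero_of_neg {e : ι → ℕ} {w : ι → ℤ} (σ : ι ≃ ι) (n : ℕ)
    (he : ∀ i, e (σ i) = e i) (hw : ∀ i, e i = n → w (σ i) = - w i) :
    coeff n (series e w) = 0 := by
  have h1 : coeff n (series e w) = ∑ᶠ i ∈ e ⁻¹' {n}, - w i := by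
    rw [coeff_series]
    symm
    refine finsum_mem_eq_of_bijOn σ ⟨?_, σ.injective.injOn, ?_⟩ fun j hj => (hw j hj).symm
    · rintro j rfl
      simp [he]
    · intro i hi
      refine ⟨σ.symm i, ?_, by simp⟩
      have := he (σ.symm i)
      simp at this hi ⊢
      omega
  have h2 : ∑ᶠ i ∈ e ⁻¹' {n}, - w i = - coeff n (series e w) := by
    rw [coeff_series]
    simp only [← finsum_neg_distrib]
  omega

/-! ### Quadratic exponents and the basic series -/

/-- The exponent `a * n ^ 2 + b * n`. -/
def quad (a b : ℕ) (n : ℤ) : ℕ := (a * n ^ 2 + b * n).toNat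

/-- The truncation in `quad` loses nothing, because `a n^2 + b n = (a - b) n^2 + b n (n + 1)` and `n
(n + 1) ≥ 0` on integers. -/
theorem quad_cast {a b : ℕ} (h : b < a) (n : ℤ) : (quad a b n : ℤ) = a * n ^ 2 + b * n := by
  apply Int.toNat_of_nonneg
  have h1 : (b : ℤ) + 1 ≤ a := by exact_mod_cast h
  have h2 : (0 : ℤ) ≤ b := by positivity
  rcases le_or_gt 0 n with hn | hn
  · positivity
  · have : (a : ℤ) * n ^ 2 + b * n = (a - b) * n ^ 2 + b * (n * (n + 1)) := by ring
    rw [this]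
    have : 0 ≤ n * (n + 1) := by nlinarith
    have : (0 : ℤ) ≤ a - b := by linarith
    positivity

theorem natAbs_le_quad {a b : ℕ} (h : b < a) (n : ℤ) : |n| ≤ quad a b n := by
  rw [quad_cast h]
  have h1 : (b : ℤ) + 1 ≤ a := by exact_mod_cast h
  have h2 : (0 : ℤ) ≤ b := by positivity
  have h3 : 0 ≤ n * (n + 1) := by
    rcases le_or_gt 0 n with hn | hn
    · positivity
    · nlinarith
  have h4 : |n| ≤ n ^ 2 := by
    rw [← sq_abs]
    rcases eq_or_ne n 0 with rfl | hn
    · simp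
    · nlinarith [Int.one_le_abs hn]
  have : (a : ℤ) * n ^ 2 + b * n = n ^ 2 + (a - b - 1) * n ^ 2 + b * (n * (n + 1)) := by ring
  rw [this]
  have : (0 : ℤ) ≤ a - b - 1 := by linarith
  have : 0 ≤ (a - b - 1) * n ^ 2 := by positivity
  have : 0 ≤ b * (n * (n + 1)) := by positivity
  linarith

theorem finiteFibers_quad {a b : ℕ} (h : b < a) : FiniteFibers (quad a b) := by
  intro m
  refine (Set.finite_Icc (-(m : ℤ)) m).subset ?_
  rintro n rfl
  exact abs_le.mp (natAbs_le_quad h n)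

/-- The sign `(-1) ^ n`. -/
def sgn (n : ℤ) : ℤ := (n.negOnePow : ℤ)

theorem sgn_add (m n : ℤ) : sgn (m + n) = sgn m * sgn n := by
  simp [sgn, Int.negOnePow_add]

theorem sgn_even {n : ℤ} (h : n % 2 = 0) : sgn n = 1 := by
  simp [sgn, Int.negOnePow_even n (Int.even_iff.mpr h)]

theorem sgn_odd {n : ℤ} (h : n % 2 = 1) : sgn n = -1 := by
  simp [sgn, Int.negOnePow_odd n (Int.odd_iff.mpr h)]

theorem sgn_congr {m n : ℤ} (h : m % 2 = n % 2) : sgn m = sgn n := by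
  rcases Int.emod_two_eq_zero_or_one n with h' | h'
  · rw [sgn_even h', sgn_even (h.trans h')]
  · rw [sgn_odd h', sgn_odd (h.trans h')]

/-- `φ(q) = ∑ q ^ (n ^ 2)`. -/
noncomputable def phi : ℤ⟦X⟧ := series (quad 1 0) fun _ => 1

/-- `φ(-q)`. -/
noncomputable def phiNeg : ℤ⟦X⟧ := series (quad 1 0) sgn

/-- `ψ(q) = ∑ q ^ (2 * n ^ 2 + n)`, the sum over all triangular exponents. -/
noncomputable def psi : ℤ⟦X⟧ := series (quad 2 1) fun _ => 1

/-- `ψ(-q)`. -/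
noncomputable def psiNeg : ℤ⟦X⟧ := series (quad 2 1) sgn

/-- `∑ q ^ (3 * n ^ 2 + 2 * n)`. -/
noncomputable def omg : ℤ⟦X⟧ := series (quad 3 2) fun _ => 1

/-- `∑ (-1) ^ n * q ^ (3 * n ^ 2 + 2 * n)`. -/
noncomputable def omgNeg : ℤ⟦X⟧ := series (quad 3 2) sgn

/-- The Euler product `∏ (1 - q ^ n)`. -/
noncomputable def euler : ℤ⟦X⟧ := series pentagonal sgn

theorem finiteFibers_pentagonal : FiniteFibers pentagonal := fun n =>
  (Set.finite_singleton n).preimage pentagonal_injective.injOn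

/-- The lattice form serves reindexing; Euler's pentagonal number theorem for `pentagonalSeries`
supplies the product. -/
theorem euler_eq_pentagonalSeries : euler = pentagonalSeries ℤ := by
  ext n
  by_cases h : ∃ k, pentagonal k = n
  · obtain ⟨k, rfl⟩ := h
    rw [coeff_pentagonalSeries_pentagonal, euler, coeff_series]
    have : pentagonal ⁻¹' {pentagonal k} = {k} := by
      ext i; simp
    rw [this, finsum_mem_singleton]
    simp only [sgn, Int.cast_id]
  · rw [coeff_pentagonalSeries_eq_zero ℤ (by simpa using h)]
    exact coeff_series_eq_zero fun i hi => h ⟨i, hi⟩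

/-! ### Gauss's product for `φ(-q)` -/

/-- The finite product `(1 - q) ⋯ (1 - q ^ n)`. -/
noncomputable def poch (n : ℕ) : ℤ⟦X⟧ := ∏ i ∈ Finset.range n, (1 - X ^ (i + 1))

theorem constantCoeff_poch (n : ℕ) : constantCoeff (poch n) = 1 := by
  simp [poch, map_prod]

theorem X_pow_dvd_poch_sub_poch {n N : ℕ} (h : n ≤ N) :
    (X : ℤ⟦X⟧) ^ (n + 1) ∣ poch N - poch n := by
  induction N, h using Nat.le_induction with
  | base => simp
  | succ N hN ih =>
    have : poch (N + 1) - poch n = (poch N - poch n) - poch N * X ^ (N + 1) := by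
      rw [poch, Finset.prod_range_succ, ← poch]
      ring
    rw [this]
    exact dvd_sub ih (Dvd.dvd.mul_left (pow_dvd_pow _ (by omega)) _)

theorem X_pow_dvd_euler_sub_poch (n : ℕ) : (X : ℤ⟦X⟧) ^ (n + 1) ∣ euler - poch n := by
  rw [X_pow_dvd_iff]
  intro m hm
  have h := coeff_prod_one_sub_X_pow_eventually_eq ℤ m
  rw [Filter.eventually_atTop] at h
  obtain ⟨s, hs⟩ := h
  obtain ⟨N, hN⟩ := s.exists_nat_subset_range
  have h1 := hs (Finset.range (N + n))
    (hN.trans (Finset.range_subset_range.mpr (Nat.le_add_right _ _)))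
  rw [← poch, ← euler_eq_pentagonalSeries] at h1
  have h2 := X_pow_dvd_iff.mp (X_pow_dvd_poch_sub_poch (Nat.le_add_left n N)) m hm
  rw [map_sub] at h2 ⊢
  rw [← h1, h2]

/-- The inverse of `poch m`, and `0` for negative `m`. -/
noncomputable def pochInv (m : ℤ) : ℤ⟦X⟧ :=
  if m < 0 then 0 else invOfUnit (poch m.toNat) 1

theorem poch_mul_pochInv (n : ℕ) : poch n * pochInv n = 1 := by
  simp only [pochInv, Int.toNat_natCast]
  rw [if_neg (by omega)]
  exact mul_invOfUnit _ _ (by simp [constantCoeff_poch])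

/-- With the value 0 at negative arguments the recursion has no exceptions: at `m = 0` the factor `1
- X ^ 0` vanishes, as does `pochInv (-1)`. -/
theorem pochInv_mul {m : ℤ} {k : ℕ} (h : 0 ≤ m → m = k) :
    pochInv m * (1 - X ^ k) = pochInv (m - 1) := by
  rcases lt_or_ge m 0 with hm | hm
  · rw [pochInv, if_pos hm, pochInv, if_pos (by omega), zero_mul]
  obtain rfl := h hm
  rcases k with _ | k
  · simp [pochInv]
  · have h1 := poch_mul_pochInv (k + 1)
    have h2 := poch_mul_pochInv k
    rw [poch, Finset.prod_range_succ, ← poch] at h1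
    have h3 : ((k + 1 : ℕ) : ℤ) - 1 = k := by omega
    rw [h3]
    linear_combination (-pochInv ↑(k + 1) * (1 - X ^ (k + 1))) * h2 + pochInv k * h1

/-- The summands of the finite form of Gauss's identity. -/
noncomputable def gaussTerm (n : ℕ) (j : ℤ) : ℤ⟦X⟧ :=
  (sgn j : ℤ⟦X⟧) * X ^ (j ^ 2).toNat * (pochInv (n - j) * pochInv (n + j))

/-- The summand of the telescoping certificate. -/
noncomputable def gaussCert (n : ℕ) (j : ℤ) : ℤ⟦X⟧ :=
  (sgn j : ℤ⟦X⟧) * X ^ (j ^ 2 - j + n).toNat * (pochInv (n - j) * pochInv (n + j - 1))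

/-- With `a = n + 1 - j` and `b = n + 1 + j`, a common factor leaves `(1 - q^(a+b)) - (1 - q^a)(1 -
q^b) = q^a (1 - q^b) + q^b (1 - q^a)`. The sign change from `j` to `j + 1` turns the right side into
a difference. -/
theorem gaussTerm_telescope (n : ℕ) {j : ℤ} (h1 : -(n + 1 : ℤ) ≤ j) (h2 : j ≤ n + 1) :
    gaussTerm (n + 1) j * (1 - X ^ (2 * (n + 1))) - gaussTerm n j =
      gaussCert (n + 1) j - gaussCert (n + 1) (j + 1) := by
  obtain ⟨a, ha⟩ := Int.eq_ofNat_of_zero_le (show 0 ≤ (n : ℤ) + 1 - j by omega)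
  obtain ⟨b, hb⟩ := Int.eq_ofNat_of_zero_le (show 0 ≤ (n : ℤ) + 1 + j by omega)
  have ea := pochInv_mul (m := (n : ℤ) + 1 - j) (k := a) fun _ => ha
  have eb := pochInv_mul (m := (n : ℤ) + 1 + j) (k := b) fun _ => hb
  have hs : sgn (j + 1) = - sgn j := by
    rw [sgn_add, sgn_odd (n := 1) rfl]; ring
  obtain ⟨s, hs'⟩ := Int.eq_ofNat_of_zero_le (sq_nonneg j)
  have e1 : ((j ^ 2 - j + (n + 1 : ℕ)).toNat) = s + a := by push_cast; omega
  have e2 : (((j + 1) ^ 2 - (j + 1) + (n + 1 : ℕ)).toNat) = s + b := by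
    rw [show (j + 1) ^ 2 = j ^ 2 + 2 * j + 1 by ring]; push_cast; omega
  have e3 : (j ^ 2).toNat = s := by omega
  have hab : 2 * (n + 1) = a + b := by omega
  simp only [gaussTerm, gaussCert, hs, e1, e2, e3, hab]
  push_cast
  rw [show (n : ℤ) + 1 - (j + 1) = n + 1 - j - 1 by ring,
    show (n : ℤ) + 1 + (j + 1) - 1 = n + 1 + j by ring,
    show (n : ℤ) - j = n + 1 - j - 1 by ring, show (n : ℤ) + j = n + 1 + j - 1 by ring,
    ← ea, ← eb]
  ring

/-- The finite form of Gauss's sum. -/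
noncomputable def gaussSum (n : ℕ) : ℤ⟦X⟧ :=
  ∑ i ∈ Finset.range (2 * n + 1), gaussTerm n (i - n)

theorem gaussSum_succ (n : ℕ) : gaussSum (n + 1) * (1 - X ^ (2 * (n + 1))) = gaussSum n := by
  -- The range grows by one index at each end, where `pochInv` has a negative argument and the term
  -- is 0.
  have h0 : gaussSum n = ∑ i ∈ Finset.range (2 * (n + 1) + 1), gaussTerm n (i - (n + 1 : ℕ)) := by
    rw [show 2 * (n + 1) + 1 = (2 * n + 1 + 1) + 1 by ring, Finset.sum_range_succ,
      Finset.sum_range_succ', gaussSum]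
    have e1 : gaussTerm n ((2 * n + 1 + 1 : ℕ) - (n + 1 : ℕ)) = 0 := by
      simp only [gaussTerm]
      rw [pochInv, if_pos (by push_cast; omega)]
      simp
    have e2 : gaussTerm n ((0 : ℕ) - (n + 1 : ℕ)) = 0 := by
      simp only [gaussTerm]
      rw [mul_comm (pochInv _), pochInv, if_pos (by push_cast; omega)]
      simp
    rw [e1, e2, add_zero, add_zero]
    refine Finset.sum_congr rfl fun i _ => ?_
    congr 1
    push_cast; ring
  rw [h0, ← sub_eq_zero, gaussSum, Finset.sum_mul, ← Finset.sum_sub_distrib]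
  have : ∀ i ∈ Finset.range (2 * (n + 1) + 1),
      gaussTerm (n + 1) (i - (n + 1 : ℕ)) * (1 - X ^ (2 * (n + 1)))
        - gaussTerm n (i - (n + 1 : ℕ)) =
      gaussCert (n + 1) (i - (n + 1 : ℕ)) - gaussCert (n + 1) ((i + 1 : ℕ) - (n + 1 : ℕ)) := by
    intro i hi
    rw [Finset.mem_range] at hi
    rw [gaussTerm_telescope n (by push_cast; omega) (by push_cast; omega)]
    congr 2
    push_cast; ring
  rw [Finset.sum_congr rfl this,
    Finset.sum_range_sub' (fun i : ℕ => gaussCert (n + 1) (i - (n + 1 : ℕ)))]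
  have e1 : gaussCert (n + 1) ((0 : ℕ) - (n + 1 : ℕ)) = 0 := by
    simp only [gaussCert]
    rw [mul_comm (pochInv _), pochInv, if_pos (by push_cast; omega)]
    simp
  have e2 : gaussCert (n + 1) ((2 * (n + 1) + 1 : ℕ) - (n + 1 : ℕ)) = 0 := by
    simp only [gaussCert]
    rw [pochInv, if_pos (by push_cast; omega)]
    simp
  rw [e1, e2, sub_zero]

theorem gaussSum_mul (n : ℕ) : gaussSum n * expand 2 two_ne_zero (poch n) = 1 := by
  induction n with
  | zero =>
    have h : invOfUnit (1 : ℤ⟦X⟧) 1 = 1 := by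
      simpa using mul_invOfUnit (1 : ℤ⟦X⟧) 1 (by simp)
    simp [gaussSum, gaussTerm, poch, pochInv, sgn, h]
  | succ n ih =>
    rw [poch, Finset.prod_range_succ, ← poch, map_mul]
    rw [← gaussSum_succ n] at ih
    simp only [map_sub, map_one, map_pow, expand_X]
    linear_combination ih

theorem X_pow_dvd_euler_mul_pochInv (n : ℕ) :
    (X : ℤ⟦X⟧) ^ (n + 1) ∣ euler * pochInv n - 1 := by
  have : euler * pochInv n - 1 = (euler - poch n) * pochInv n := by
    rw [sub_mul, poch_mul_pochInv]
  rw [this]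
  exact Dvd.dvd.mul_right (X_pow_dvd_euler_sub_poch n) _

theorem sum_range_eq_sum_Icc (n : ℕ) (f : ℤ → ℤ⟦X⟧) :
    ∑ i ∈ Finset.range (2 * n + 1), f (i - n) = ∑ j ∈ Finset.Icc (-(n : ℤ)) n, f j := by
  refine Finset.sum_nbij' (fun i => (i : ℤ) - n) (fun j => (j + n).toNat) ?_ ?_ ?_ ?_ ?_
  · intro i hi; simp at hi ⊢; omega
  · intro i hi; simp at hi ⊢; omega
  · intro i hi; simp
  · intro i hi; simp at hi ⊢; omega
  · intro i hi; rfl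

theorem X_pow_dvd_phiNeg_sub (n : ℕ) :
    (X : ℤ⟦X⟧) ^ (n + 1) ∣
      phiNeg - ∑ j ∈ Finset.Icc (-(n : ℤ)) n, (sgn j : ℤ⟦X⟧) * X ^ (j ^ 2).toNat := by
  rw [X_pow_dvd_iff]
  intro m hm
  rw [map_sub, map_sum, sub_eq_zero, phiNeg,
    coeff_series_eq_sum _ (finiteFibers_quad one_pos)]
  have : ∀ j : ℤ, coeff m ((sgn j : ℤ⟦X⟧) * X ^ (j ^ 2).toNat) =
      if m = (j ^ 2).toNat then sgn j else 0 := by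
    intro j
    rw [show (sgn j : ℤ⟦X⟧) = C (sgn j) by simp, coeff_C_mul, coeff_X_pow]
    simp
  simp only [this]
  rw [← Finset.sum_filter]
  refine Finset.sum_congr ?_ fun _ _ => rfl
  ext j
  have h := natAbs_le_quad one_pos j
  simp only [Set.Finite.mem_toFinset, Set.mem_preimage, Set.mem_singleton_iff, Finset.mem_filter,
    Finset.mem_Icc]
  have h' : quad 1 0 j = (j ^ 2).toNat := by simp [quad]
  rw [h'] at h ⊢
  constructor
  · rintro rfl
    refine ⟨?_, rfl⟩
    exact abs_le.mp (h.trans (by omega))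
  · exact fun h => h.2.symm

/-- The limit `n → ∞` of `gaussSum_mul` times `euler ^ 2`, made precise modulo `X ^ (n + 1)` for
every `n`. -/
theorem phiNeg_mul_euler : phiNeg * expand 2 two_ne_zero euler = euler ^ 2 := by
  have key : ∀ n : ℕ, (X : ℤ⟦X⟧) ^ (n + 1) ∣ phiNeg * expand 2 two_ne_zero euler - euler ^ 2 := by
    intro n
    have h1 : (X : ℤ⟦X⟧) ^ (n + 1) ∣ euler ^ 2 * gaussSum n - phiNeg := by
      have e : euler ^ 2 * gaussSum n - phiNeg =
          (∑ j ∈ Finset.Icc (-(n : ℤ)) n, (sgn j : ℤ⟦X⟧) * (X ^ (j ^ 2).toNat *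
            ((euler * pochInv (n - j)) * (euler * pochInv (n + j)) - 1))) -
          (phiNeg - ∑ j ∈ Finset.Icc (-(n : ℤ)) n, (sgn j : ℤ⟦X⟧) * X ^ (j ^ 2).toNat) := by
        rw [gaussSum, sum_range_eq_sum_Icc, Finset.mul_sum, sub_sub_eq_add_sub,
          ← Finset.sum_add_distrib]
        congr 1
        refine Finset.sum_congr rfl fun j _ => ?_
        rw [gaussTerm]
        ring
      rw [e]
      refine dvd_sub (Finset.dvd_sum fun j hj => Dvd.dvd.mul_left ?_ _) (X_pow_dvd_phiNeg_sub n)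
      rw [Finset.mem_Icc] at hj
      obtain ⟨a, ha⟩ := Int.eq_ofNat_of_zero_le (show 0 ≤ (n : ℤ) - j by omega)
      obtain ⟨b, hb⟩ := Int.eq_ofNat_of_zero_le (show 0 ≤ (n : ℤ) + j by omega)
      rw [ha, hb]
      -- Near `j = ± n` one of the quotients is a poor approximation to 1, but the factor `X ^ (j ^
      -- 2)` compensates, since `|j| ≤ j ^ 2`.
      have hE : ∀ m : ℕ, n ≤ m + (j ^ 2).toNat → (X : ℤ⟦X⟧) ^ (n + 1) ∣
          X ^ (j ^ 2).toNat * (euler * pochInv m - 1) := by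
        intro m hm
        refine (pow_dvd_pow X (show n + 1 ≤ (j ^ 2).toNat + (m + 1) by omega)).trans ?_
        rw [pow_add]
        exact mul_dvd_mul_left _ (X_pow_dvd_euler_mul_pochInv m)
      have hj1 : j ≤ j ^ 2 := by nlinarith [sq_nonneg j, Int.le_self_sq j]
      have hj2 : -j ≤ j ^ 2 := by nlinarith [Int.le_self_sq (-j)]
      have : X ^ (j ^ 2).toNat * (euler * pochInv (a : ℤ) * (euler * pochInv (b : ℤ)) - 1) =
          X ^ (j ^ 2).toNat * (euler * pochInv a - 1) * (euler * pochInv b) +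
          X ^ (j ^ 2).toNat * (euler * pochInv b - 1) := by ring
      exact this ▸ dvd_add (Dvd.dvd.mul_right (hE a (by omega)) _) (hE b (by omega))
    have h2 : (X : ℤ⟦X⟧) ^ (n + 1) ∣ expand 2 two_ne_zero (euler - poch n) := by
      have := map_dvd (expand 2 two_ne_zero) (X_pow_dvd_euler_sub_poch n)
      rw [map_pow, expand_X, ← pow_mul] at this
      exact (pow_dvd_pow X (by omega)).trans this
    have h3 := gaussSum_mul n
    have : phiNeg * expand 2 two_ne_zero euler - euler ^ 2 =
        phiNeg * expand 2 two_ne_zero (euler - poch n) -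
          (euler ^ 2 * gaussSum n - phiNeg) * expand 2 two_ne_zero (poch n) := by
      rw [map_sub]
      linear_combination euler ^ 2 * h3
    rw [this]
    exact dvd_sub (Dvd.dvd.mul_left h2 _) (Dvd.dvd.mul_right h1 _)
  rw [← sub_eq_zero]
  ext n
  simpa using X_pow_dvd_iff.mp (key n) n (by omega)

/-! ### Identities between theta series that come from maps between lattices -/

theorem quad_one_zero (n : ℤ) : (quad 1 0 n : ℤ) = n ^ 2 := by
  rw [quad_cast one_pos]; push_cast; ring

theorem quad_two_one (n : ℤ) : (quad 2 1 n : ℤ) = 2 * n ^ 2 + n := by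
  rw [quad_cast (by norm_num)]; push_cast; ring

theorem quad_three_two (n : ℤ) : (quad 3 2 n : ℤ) = 3 * n ^ 2 + 2 * n := by
  rw [quad_cast (by norm_num)]; push_cast; ring

theorem finiteFibers_quad_one_zero : FiniteFibers (quad 1 0) := finiteFibers_quad (by norm_num)

theorem finiteFibers_quad_two_one : FiniteFibers (quad 2 1) := finiteFibers_quad (by norm_num)

theorem finiteFibers_quad_three_two : FiniteFibers (quad 3 2) := finiteFibers_quad (by norm_num)

theorem exists_sq_eq_add_two_mul (n : ℤ) : ∃ k, n ^ 2 = n + 2 * k := by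
  obtain ⟨k, hk⟩ := Int.even_mul_pred_self n
  exact ⟨k, by linear_combination hk⟩

theorem FiniteFibers.add {ι κ : Type*} {e : ι → ℕ} {e' : κ → ℕ} (he : FiniteFibers e)
    (he' : FiniteFibers e') : FiniteFibers fun x : ι × κ => e x.1 + e' x.2 := by
  intro n
  refine ((Set.Finite.biUnion (Set.finite_Iic n) fun m _ => he m).prod
    (Set.Finite.biUnion (Set.finite_Iic n) fun m _ => he' m)).subset ?_
  rintro ⟨a, b⟩ h
  simp at h ⊢
  omega

theorem FiniteFibers.add_const {ι : Type*} {e : ι → ℕ} (he : FiniteFibers e) (s : ℕ) :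
    FiniteFibers fun i => e i + s := by
  intro n
  refine (he (n - s)).subset ?_
  rintro i rfl
  simp

/-- Splitting the exponents `n ^ 2` according to the parity of `n`. -/
theorem series_sq_two (w : ℤ → ℤ) :
    series (quad 1 0) w = expand 4 four_ne_zero (series (quad 1 0) fun m => w (2 * m)) +
      X * expand 8 (by norm_num) (series (quad 2 1) fun m => w (4 * m + 1) + w (-(4 * m + 1))) := by
  rw [← series_add _ _ finiteFibers_quad_two_one, map_add, mul_add, expand_series, expand_series,
    expand_series, ← pow_one X, X_pow_mul_series, X_pow_mul_series,
    ← series_sum _ _ ((finiteFibers_quad_two_one.const_mul (by norm_num)).add_const 1)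
      ((finiteFibers_quad_two_one.const_mul (by norm_num)).add_const 1),
    ← series_sum _ _ (finiteFibers_quad_one_zero.const_mul (by norm_num))]
  -- Every odd integer is `4m + 1` or `-(4m + 1)` for exactly one `m`, and `(4m + 1)^2 = 8(2m^2 + m)
  -- + 1`.
  · refine series_reindex
      (Sum.elim (fun m => 2 * m) (Sum.elim (fun m => 4 * m + 1) fun m => -(4 * m + 1)))
      ⟨?_, ?_⟩ ?_ ?_
    · rintro (a | a | a) (b | b | b) h <;> simp at h ⊢ <;> omega
    · intro n
      rcases (by omega : n % 2 = 0 ∨ n % 4 = 1 ∨ n % 4 = 3) with h | h | h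
      · exact ⟨Sum.inl (n / 2), by simp; omega⟩
      · exact ⟨Sum.inr (Sum.inl (n / 4)), by simp; omega⟩
      · exact ⟨Sum.inr (Sum.inr (-(n + 1) / 4)), by simp; omega⟩
    · rintro (a | a | a) <;> simp only [Sum.elim_inl, Sum.elim_inr] <;> zify <;>
        simp only [quad_one_zero, quad_two_one] <;> ring
    · rintro (a | a | a) <;> rfl
  · rintro n
    refine (((finiteFibers_quad_two_one.const_mul (show 8 ≠ 0 by norm_num)).add_const 1 n).image
      Sum.inl |>.union (((finiteFibers_quad_two_one.const_mul
        (show 8 ≠ 0 by norm_num)).add_const 1 n).image Sum.inr)).subset ?_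
    rintro (a | a) h <;> simpa using h

/-- Splitting the exponents `n ^ 2` according to `n` modulo `3`. -/
theorem series_sq_three (w : ℤ → ℤ) :
    series (quad 1 0) w = expand 9 (by norm_num) (series (quad 1 0) fun m => w (3 * m)) +
      X * expand 3 three_ne_zero
        (series (quad 3 2) fun m => w (3 * m + 1) + w (-(3 * m + 1))) := by
  rw [← series_add _ _ finiteFibers_quad_three_two, map_add, mul_add, expand_series, expand_series,
    expand_series, ← pow_one X, X_pow_mul_series, X_pow_mul_series,
    ← series_sum _ _ ((finiteFibers_quad_three_two.const_mul (by norm_num)).add_const 1)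
      ((finiteFibers_quad_three_two.const_mul (by norm_num)).add_const 1),
    ← series_sum _ _ (finiteFibers_quad_one_zero.const_mul (by norm_num))]
  · refine series_reindex
      (Sum.elim (fun m => 3 * m) (Sum.elim (fun m => 3 * m + 1) fun m => -(3 * m + 1)))
      ⟨?_, ?_⟩ ?_ ?_
    · rintro (a | a | a) (b | b | b) h <;> simp at h ⊢ <;> omega
    · intro n
      rcases (by omega : n % 3 = 0 ∨ n % 3 = 1 ∨ n % 3 = 2) with h | h | h
      · exact ⟨Sum.inl (n / 3), by simp; omega⟩
      · exact ⟨Sum.inr (Sum.inl (n / 3)), by simp; omega⟩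
      · exact ⟨Sum.inr (Sum.inr (-(n + 1) / 3)), by simp; omega⟩
    · rintro (a | a | a) <;> simp only [Sum.elim_inl, Sum.elim_inr] <;> zify <;>
        simp only [quad_one_zero, quad_three_two] <;> ring
    · rintro (a | a | a) <;> rfl
  · rintro n
    refine (((finiteFibers_quad_three_two.const_mul (show 3 ≠ 0 by norm_num)).add_const 1 n).image
      Sum.inl |>.union (((finiteFibers_quad_three_two.const_mul
        (show 3 ≠ 0 by norm_num)).add_const 1 n).image Sum.inr)).subset ?_
    rintro (a | a) h <;> simpa using h

theorem series_const_mul {ι : Type*} (e : ι → ℕ) (c : ℤ) (w : ι → ℤ) (he : FiniteFibers e) :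
    series e (fun i => c * w i) = (c : ℤ⟦X⟧) * series e w := by
  ext n
  rw [show (c : ℤ⟦X⟧) = C c by simp, coeff_C_mul, coeff_series_eq_sum _ he,
    coeff_series_eq_sum _ he, Finset.mul_sum]

theorem phi_eq_two : phi = expand 4 four_ne_zero phi + 2 * X * expand 8 (by norm_num) psi := by
  have h := series_sq_two fun _ => 1
  have h2 := series_const_mul (quad 2 1) 2 (fun _ => 1) finiteFibers_quad_two_one
  norm_num at h h2
  rw [h2, map_mul, map_ofNat] at h
  rw [phi, psi]
  linear_combination h

theorem phiNeg_eq_two :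
    phiNeg = expand 4 four_ne_zero phi - 2 * X * expand 8 (by norm_num) psi := by
  have h := series_sq_two sgn
  have h2 := series_const_mul (quad 2 1) (-2) (fun _ => 1) finiteFibers_quad_two_one
  have e1 : (fun m : ℤ => sgn (2 * m)) = fun _ => 1 := by
    ext m; exact sgn_even (by omega)
  have e2 : (fun m : ℤ => sgn (4 * m + 1) + sgn (-(4 * m + 1))) = fun _ => -2 := by
    ext m; rw [sgn_odd (by omega), sgn_odd (by omega)]; rfl
  norm_num at h2
  rw [e1, e2, h2, map_neg, map_mul, map_ofNat] at h
  rw [phi, psi, phiNeg]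
  linear_combination h

theorem phi_eq_three :
    phi = expand 9 (by norm_num) phi + 2 * X * expand 3 three_ne_zero omg := by
  have h := series_sq_three fun _ => 1
  have h2 := series_const_mul (quad 3 2) 2 (fun _ => 1) finiteFibers_quad_three_two
  norm_num at h h2
  rw [h2, map_mul, map_ofNat] at h
  rw [phi, omg]
  linear_combination h

theorem phiNeg_eq_three :
    phiNeg = expand 9 (by norm_num) phiNeg - 2 * X * expand 3 three_ne_zero omgNeg := by
  have h := series_sq_three sgn
  have h2 := series_const_mul (quad 3 2) (-2) sgn finiteFibers_quad_three_two
  have e1 : (fun m : ℤ => sgn (3 * m)) = sgn := by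
    ext m; exact sgn_congr (by omega)
  have e2 : (fun m : ℤ => sgn (3 * m + 1) + sgn (-(3 * m + 1))) = fun m => -2 * sgn m := by
    ext m
    rw [sgn_congr (show (3 * m + 1) % 2 = (m + 1) % 2 by omega),
      sgn_congr (show (-(3 * m + 1)) % 2 = (m + 1) % 2 by omega), sgn_add, sgn_odd (n := 1) rfl]
    ring
  rw [e1, e2, h2, map_mul, map_intCast] at h
  rw [omgNeg, phiNeg]
  push_cast at h
  linear_combination h

/-- In `∑ (-1)^y q^(x^2 + y^2)`, swapping `x` and `y` cancels the odd exponents. For even ones put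
`x = a + b`, `y = a - b`, so that `x^2 + y^2 = 2(a^2 + b^2)`. -/
theorem phi_mul_phiNeg : phi * phiNeg = (expand 2 two_ne_zero phiNeg) ^ 2 := by
  have hA : phi * phiNeg = series (fun x : ℤ × ℤ => quad 1 0 x.1 + quad 1 0 x.2)
      (fun x => 1 * sgn x.2) :=
    series_mul _ _ finiteFibers_quad_one_zero finiteFibers_quad_one_zero
  have h1 : dissect 2 1 (phi * phiNeg) = 0 := by
    ext n
    rw [coeff_dissect, hA, map_zero]
    refine coeff_series_eq_zero_of_neg (Equiv.prodComm ℤ ℤ) _ (fun x => add_comm _ _) ?_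
    rintro ⟨x, y⟩ h
    simp only [Equiv.prodComm_apply, Prod.swap, one_mul] at h ⊢
    zify at h
    simp only [quad_one_zero] at h
    obtain ⟨k, hk⟩ := exists_sq_eq_add_two_mul x
    obtain ⟨l, hl⟩ := exists_sq_eq_add_two_mul y
    rcases Int.emod_two_eq_zero_or_one x with hx | hx
    · rw [sgn_even hx, sgn_odd (n := y) (by omega)]; rfl
    · rw [sgn_odd hx, sgn_even (n := y) (by omega)]
  have h0 : dissect 2 0 (phi * phiNeg) = phiNeg ^ 2 := by
    have h2 := series_mul sgn sgn finiteFibers_quad_one_zero finiteFibers_quad_one_zero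
    rw [hA, sq, phiNeg, h2]
    refine dissect_series 2 0 two_pos (fun x => (x.1 + x.2, x.1 - x.2)) ?_ ?_ ?_ ?_
    · rintro ⟨a, b⟩ ⟨c, d⟩ h
      simp only [Prod.mk.injEq] at h ⊢
      omega
    · rintro ⟨a, b⟩
      zify
      simp only [quad_one_zero]
      ring
    · rintro ⟨a, b⟩
      rw [one_mul, ← sgn_add]
      exact sgn_congr (by simp only; omega)
    · rintro ⟨x, y⟩ h
      zify at h
      simp only [quad_one_zero] at h
      obtain ⟨k, hk⟩ := exists_sq_eq_add_two_mul x
      obtain ⟨l, hl⟩ := exists_sq_eq_add_two_mul y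
      exact ⟨((x + y) / 2, (x - y) / 2), by simp only [Prod.mk.injEq]; omega⟩
  rw [eq_expand_add_expand (phi * phiNeg), h0, h1]
  simp

/-- With `s = a + b`, the exponent `2a^2 + a + 2b^2 + b` equals `(a - b)^2 + s(s + 1)`, and `s(s +
1) = 2(2m^2 + m)` both for `s = 2m` and for `s = -2m - 1`. -/
theorem psi_sq : psi ^ 2 = phi * expand 2 two_ne_zero psi := by
  rw [sq, psi, phi, expand_series, series_mul _ _ finiteFibers_quad_two_one
    finiteFibers_quad_two_one, series_mul _ _ finiteFibers_quad_one_zero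
    (finiteFibers_quad_two_one.const_mul two_ne_zero)]
  symm
  refine series_reindex (fun x => (x.1 - x.2,
    if (x.1 - x.2) % 2 = 0 then (x.1 + x.2) / 2 else -(x.1 + x.2 + 1) / 2)) ⟨?_, ?_⟩ ?_ ?_
  · rintro ⟨a, b⟩ ⟨c, d⟩ h
    simp only [Prod.mk.injEq] at h ⊢
    split_ifs at h <;> omega
  · rintro ⟨n, m⟩
    rcases Int.emod_two_eq_zero_or_one n with hn | hn
    · refine ⟨((2 * m + n) / 2, (2 * m - n) / 2), ?_⟩
      simp only [Prod.mk.injEq]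
      rw [if_pos (by omega)]
      omega
    · refine ⟨((-2 * m - 1 + n) / 2, (-2 * m - 1 - n) / 2), ?_⟩
      simp only [Prod.mk.injEq]
      rw [if_neg (by omega)]
      omega
  · rintro ⟨a, b⟩
    zify
    simp only [quad_one_zero, quad_two_one]
    split_ifs with h
    · obtain ⟨m, hm⟩ : ∃ m, a + b = 2 * m := ⟨(a + b) / 2, by omega⟩
      have : (a + b) / 2 = m := by omega
      rw [this]
      obtain rfl : a = 2 * m - b := by omega
      ring
    · obtain ⟨m, hm⟩ : ∃ m, -(a + b + 1) = 2 * m := ⟨-(a + b + 1) / 2, by omega⟩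
      have : -(a + b + 1) / 2 = m := by omega
      rw [this]
      obtain rfl : a = -2 * m - 1 - b := by omega
      ring
  · intro; rfl

/-- The argument of `phi_mul_phiNeg`: the same swap and the same substitution, now with exponent
`2(2a^2 + a + 2b^2)`. -/
theorem psi_mul_psiNeg :
    psi * psiNeg = expand 2 two_ne_zero psiNeg * expand 4 four_ne_zero phiNeg := by
  have hA : psi * psiNeg = series (fun x : ℤ × ℤ => quad 2 1 x.1 + quad 2 1 x.2)
      (fun x => 1 * sgn x.2) :=
    series_mul _ _ finiteFibers_quad_two_one finiteFibers_quad_two_one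
  have h1 : dissect 2 1 (psi * psiNeg) = 0 := by
    ext n
    rw [coeff_dissect, hA, map_zero]
    refine coeff_series_eq_zero_of_neg (Equiv.prodComm ℤ ℤ) _ (fun x => add_comm _ _) ?_
    rintro ⟨x, y⟩ h
    simp only [Equiv.prodComm_apply, Prod.swap, one_mul] at h ⊢
    zify at h
    simp only [quad_two_one] at h
    rcases Int.emod_two_eq_zero_or_one x with hx | hx
    · rw [sgn_even hx, sgn_odd (n := y) (by omega)]; rfl
    · rw [sgn_odd hx, sgn_even (n := y) (by omega)]
  have h0 : dissect 2 0 (psi * psiNeg) = psiNeg * expand 2 two_ne_zero phiNeg := by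
    rw [hA, psiNeg, phiNeg, expand_series, series_mul _ _ finiteFibers_quad_two_one
      (finiteFibers_quad_one_zero.const_mul two_ne_zero)]
    refine dissect_series 2 0 two_pos (fun x => (x.1 + x.2, x.1 - x.2)) ?_ ?_ ?_ ?_
    · rintro ⟨a, b⟩ ⟨c, d⟩ h
      simp only [Prod.mk.injEq] at h ⊢
      omega
    · rintro ⟨a, b⟩
      zify
      simp only [quad_two_one, quad_one_zero]
      ring
    · rintro ⟨a, b⟩
      rw [one_mul, ← sgn_add]
      exact sgn_congr (by simp only; omega)
    · rintro ⟨x, y⟩ h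
      zify at h
      simp only [quad_two_one] at h
      exact ⟨((x + y) / 2, (x - y) / 2), by simp only [Prod.mk.injEq]; omega⟩
  rw [eq_expand_add_expand (psi * psiNeg), h0, h1, map_mul,
    expand_comp two_ne_zero two_ne_zero four_ne_zero rfl]
  simp

/-- For `x - y` odd, `(x, y) = ±(a + 3b + 1, a - b)` in exactly one way, the sign being fixed by `x
- y` modulo 4. Then `x^2 + 3y^2 = 2((2a^2 + a) + 3(2b^2 + b)) + 1`; the two signs give the factor 2.
-/
theorem dissect_phi_mul_phiNeg_three :
    dissect 2 1 (phi * expand 3 three_ne_zero phiNeg) =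
      2 * (psiNeg * expand 3 three_ne_zero psiNeg) := by
  have hf := finiteFibers_quad_two_one.add
    (finiteFibers_quad_two_one.const_mul three_ne_zero)
  rw [two_mul, phi, phiNeg, psiNeg, expand_series, expand_series,
    series_mul _ _ finiteFibers_quad_one_zero (finiteFibers_quad_one_zero.const_mul three_ne_zero),
    series_mul _ _ finiteFibers_quad_two_one (finiteFibers_quad_two_one.const_mul three_ne_zero),
    ← series_sum _ _ hf hf]
  refine dissect_series 2 1 one_lt_two
    (Sum.elim (fun x => (x.1 + 3 * x.2 + 1, x.1 - x.2))
      fun x => (-(x.1 + 3 * x.2 + 1), -(x.1 - x.2))) ?_ ?_ ?_ ?_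
  · rintro (⟨a, b⟩ | ⟨a, b⟩) (⟨c, d⟩ | ⟨c, d⟩) h <;>
      simp only [Sum.elim_inl, Sum.elim_inr, Prod.mk.injEq, Sum.inl.injEq, Sum.inr.injEq,
        reduceCtorEq] at h ⊢ <;> omega
  · rintro (⟨a, b⟩ | ⟨a, b⟩) <;> simp only [Sum.elim_inl, Sum.elim_inr] <;> zify <;>
      simp only [quad_one_zero, quad_two_one] <;> ring
  · rintro (⟨a, b⟩ | ⟨a, b⟩) <;> simp only [Sum.elim_inl, Sum.elim_inr, one_mul] <;>
      rw [← sgn_add] <;> exact sgn_congr (by omega)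
  · rintro ⟨x, y⟩ h
    zify at h
    simp only [quad_one_zero] at h
    obtain ⟨k, hk⟩ := exists_sq_eq_add_two_mul x
    obtain ⟨l, hl⟩ := exists_sq_eq_add_two_mul y
    rcases (by omega : (x - y) % 4 = 1 ∨ (x - y) % 4 = 3) with h' | h'
    · exact ⟨Sum.inl (y + (x - y - 1) / 4, (x - y - 1) / 4), by
        simp only [Sum.elim_inl, Prod.mk.injEq]; omega⟩
    · exact ⟨Sum.inr (-y + (y - x - 1) / 4, (y - x - 1) / 4), by
        simp only [Sum.elim_inr, Prod.mk.injEq]; omega⟩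

/-- If the exponent at `(a, b)` is `2e + 1`, completing squares gives `4e + 3 = (a + 3b + 1)^2 + 3(a
- b)^2`. Put `a + 3b + 1 = 2n` and `a - b = ±(4m + 1)`, with the sign determined by the parity of
`n`; then `e = 6(2m^2 + m) + n^2`. -/
theorem dissect_psi_mul_psi_three :
    dissect 2 1 (psi * expand 3 three_ne_zero psi) =
      expand 6 (by norm_num) psi * phi := by
  rw [phi, psi, expand_series, expand_series, series_mul _ _ finiteFibers_quad_two_one
    (finiteFibers_quad_two_one.const_mul three_ne_zero),
    series_mul _ _ (finiteFibers_quad_two_one.const_mul (by norm_num)) finiteFibers_quad_one_zero]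
  refine dissect_series 2 1 one_lt_two
    (fun x => if x.2 % 2 = 0 then (x.2 / 2 - 3 * x.1 - 1, x.2 / 2 + x.1)
      else ((x.2 - 1) / 2 + 3 * x.1 + 1, (x.2 - 1) / 2 - x.1)) ?_ ?_ ?_ ?_
  · rintro ⟨a, b⟩ ⟨c, d⟩ h
    simp only [Prod.mk.injEq] at h ⊢
    split_ifs at h <;> simp only [Prod.mk.injEq] at h <;> omega
  · rintro ⟨m, n⟩
    simp only
    split_ifs with h
    · obtain ⟨k, rfl⟩ : ∃ k, n = 2 * k := ⟨n / 2, by omega⟩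
      rw [show 2 * k / 2 = k by omega]
      zify
      simp only [quad_one_zero, quad_two_one]
      ring
    · obtain ⟨k, rfl⟩ : ∃ k, n = 2 * k + 1 := ⟨n / 2, by omega⟩
      rw [show (2 * k + 1 - 1) / 2 = k by omega]
      zify
      simp only [quad_one_zero, quad_two_one]
      ring
  · intro; rfl
  · rintro ⟨a, b⟩ h
    zify at h
    simp only [quad_two_one] at h
    rcases (by omega : (a + 3 * b + 1) % 4 = 0 ∨ (a + 3 * b + 1) % 4 = 2) with h' | h'
    · refine ⟨(-(a - b + 1) / 4, (a + 3 * b + 1) / 2), ?_⟩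
      simp only
      rw [if_pos (by omega), Prod.mk.injEq]
      omega
    · refine ⟨((a - b - 1) / 4, (a + 3 * b + 1) / 2), ?_⟩
      simp only
      rw [if_neg (by omega), Prod.mk.injEq]
      omega

/-- The weights `(-1)^y + (-1)^x` vanish unless `x + y` is even. Then `x = a - b`, `y = -(a + b)`
turns `3x^2 + 3y^2 + 2y` into four times a sum of two pentagonal numbers. -/
theorem phi_mul_omgNeg_add_phiNeg_mul_omg :
    expand 3 three_ne_zero phi * omgNeg + expand 3 three_ne_zero phiNeg * omg =
      2 * expand 4 four_ne_zero (euler ^ 2) := by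
  have hf := (finiteFibers_quad_one_zero.const_mul three_ne_zero).add finiteFibers_quad_three_two
  have hA : expand 3 three_ne_zero phi * omgNeg + expand 3 three_ne_zero phiNeg * omg =
      series (fun x : ℤ × ℤ => 3 * quad 1 0 x.1 + quad 3 2 x.2)
        (fun x => 1 * sgn x.2 + sgn x.1 * 1) := by
    rw [← series_add _ _ hf, phi, phiNeg, omg, omgNeg, expand_series, expand_series,
      series_mul _ _ (finiteFibers_quad_one_zero.const_mul three_ne_zero)
        finiteFibers_quad_three_two,
      series_mul _ _ (finiteFibers_quad_one_zero.const_mul three_ne_zero)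
        finiteFibers_quad_three_two]
  have hparity : ∀ x : ℤ × ℤ,
      ((3 * quad 1 0 x.1 + quad 3 2 x.2 : ℕ) : ℤ) % 2 = (x.1 + x.2) % 2 := by
    rintro ⟨x, y⟩
    push_cast
    simp only [quad_one_zero, quad_three_two]
    obtain ⟨k, hk⟩ := exists_sq_eq_add_two_mul x
    obtain ⟨l, hl⟩ := exists_sq_eq_add_two_mul y
    omega
  have h1 : dissect 2 1 (expand 3 three_ne_zero phi * omgNeg +
      expand 3 three_ne_zero phiNeg * omg) = 0 := by
    ext n
    rw [coeff_dissect, hA, map_zero, coeff_series]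
    refine finsum_mem_eq_zero_of_forall_eq_zero fun x hx => ?_
    have h := hparity x
    rw [Set.mem_preimage, Set.mem_singleton_iff] at hx
    rw [hx] at h
    rcases Int.emod_two_eq_zero_or_one x.1 with hx | hx
    · rw [sgn_even hx, sgn_odd (n := x.2) (by omega)]; rfl
    · rw [sgn_odd hx, sgn_even (n := x.2) (by omega)]; rfl
  have h0 : dissect 2 0 (expand 3 three_ne_zero phi * omgNeg +
      expand 3 three_ne_zero phiNeg * omg) = 2 * expand 2 two_ne_zero (euler ^ 2) := by
    have hp := finiteFibers_pentagonal.add finiteFibers_pentagonal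
    have h2 := series_const_mul (fun x : ℤ × ℤ => 2 * (pentagonal x.1 + pentagonal x.2)) 2
      (fun x => sgn x.1 * sgn x.2) (hp.const_mul two_ne_zero)
    rw [hA, sq, euler, series_mul _ _ finiteFibers_pentagonal finiteFibers_pentagonal,
      expand_series]
    push_cast at h2
    rw [← h2]
    refine dissect_series 2 0 two_pos (fun x => (x.1 - x.2, -(x.1 + x.2))) ?_ ?_ ?_ ?_
    · rintro ⟨a, b⟩ ⟨c, d⟩ h
      simp only [Prod.mk.injEq] at h ⊢
      omega
    · rintro ⟨a, b⟩
      zify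
      simp only [quad_one_zero, quad_three_two]
      linear_combination -2 * two_mul_natCast_pentagonal a - 2 * two_mul_natCast_pentagonal b
    · rintro ⟨a, b⟩
      simp only
      rw [← sgn_add, sgn_congr (show (-(a + b)) % 2 = (a + b) % 2 by omega),
        sgn_congr (show (a - b) % 2 = (a + b) % 2 by omega)]
      ring
    · rintro ⟨x, y⟩ h
      have h' := hparity (x, y)
      have h2 : (x + y) % 2 = 0 := by
        simp only at h h'
        omega
      exact ⟨((x - y) / 2, (-x - y) / 2), by simp only [Prod.mk.injEq]; omega⟩
  rw [eq_expand_add_expand (expand 3 three_ne_zero phi * omgNeg +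
    expand 3 three_ne_zero phiNeg * omg), h0, h1, map_mul,
    expand_comp two_ne_zero two_ne_zero four_ne_zero rfl]
  rw [map_ofNat, map_zero, mul_zero, add_zero]

/-! ### Rigidity of power series under `q ↦ q ^ k` -/

theorem eq_one_of_eq_expand {R : Type*} [CommRing R] {k : ℕ} (hk : 1 < k) {f : R⟦X⟧}
    (h0 : constantCoeff f = 1) (h : f = expand k (by omega) f) : f = 1 := by
  ext n
  induction n using Nat.strong_induction_on with
  | _ n ih =>
    rcases Nat.eq_zero_or_pos n with rfl | hn
    · simpa using h0
    · rw [h, coeff_expand]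
      split_ifs with hd
      · obtain ⟨m, rfl⟩ := hd
        rw [Nat.mul_div_cancel_left _ (by omega)]
        have hm : 0 < m := Nat.pos_of_mul_pos_left hn
        rw [ih m (by nlinarith), coeff_one, coeff_one, if_neg (by omega), if_neg (by omega)]
      · rw [coeff_one, if_neg (by omega)]

/-- If `c q^n` is the lowest term of `f - 1`, then `f^2` has coefficient `2c` at `q^n`, while
`f(q^2) - 1` starts at `q^(2n)`. Hence `2c = 0`. -/
theorem eq_one_of_sq_eq_expand {f : ℤ⟦X⟧} (h0 : constantCoeff f = 1)
    (h : f ^ 2 = expand 2 two_ne_zero f) : f = 1 := by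
  by_contra hne
  have hg : f - 1 ≠ 0 := sub_ne_zero.mpr hne
  obtain ⟨g, hg'⟩ := X_pow_order_dvd (φ := f - 1)
  set n := (f - 1).order.toNat with hn
  have hc : coeff n (f - 1) ≠ 0 := coeff_order (by simpa using hg)
  have hn0 : n ≠ 0 := by
    intro h'
    rw [h'] at hc
    simp [h0] at hc
  have h2 : (f - 1) ^ 2 + 2 * (f - 1) = expand 2 two_ne_zero (f - 1) := by
    rw [map_sub, map_one]
    linear_combination h
  have h3 : coeff n ((f - 1) ^ 2) = 0 := by
    rw [hg']
    have : (X ^ n * g) ^ 2 = X ^ (n + 1) * (X ^ (n - 1) * g ^ 2) := by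
      rw [mul_pow, ← mul_assoc, ← pow_add, ← pow_mul]
      congr 2
      omega
    rw [this, coeff_X_pow_mul', if_neg (by omega)]
  have h4 : coeff n (expand 2 two_ne_zero (f - 1)) = 0 := by
    rw [coeff_expand]
    split_ifs with hd
    · apply coeff_of_lt_order_toNat
      rw [← hn]
      omega
    · rfl
  have h5 := congrArg (coeff n) h2
  rw [map_add, h3, h4, two_mul, map_add] at h5
  omega

theorem ne_zero_of_constantCoeff {f : ℤ⟦X⟧} (h : constantCoeff f = 1) : f ≠ 0 := by
  rintro rfl
  simp at h

theorem exists_mul_eq_one {f : ℤ⟦X⟧} (h : constantCoeff f = 1) :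
    ∃ g, f * g = 1 ∧ constantCoeff g = 1 := by
  have h' := mul_invOfUnit f 1 (by simpa using h)
  refine ⟨_, h', ?_⟩
  have := congrArg constantCoeff h'
  rwa [map_mul, h, one_mul, map_one] at this

theorem eq_of_mul_expand_eq {f g : ℤ⟦X⟧} (hf : constantCoeff f = 1) (hg : constantCoeff g = 1)
    (h : f * expand 2 two_ne_zero g = g * expand 2 two_ne_zero f) : f = g := by
  obtain ⟨i, hi, hi0⟩ := exists_mul_eq_one hg
  have hi2 := congrArg (expand 2 two_ne_zero) hi
  rw [map_mul, map_one] at hi2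
  have : f * i = 1 := by
    refine eq_one_of_eq_expand one_lt_two (by simp [hf, hi0]) ?_
    rw [map_mul]
    linear_combination i * expand 2 two_ne_zero i * h - f * i * hi2
      + expand 2 two_ne_zero f * expand 2 two_ne_zero i * hi
  linear_combination g * this - f * hi

theorem eq_of_sq_mul_expand_eq {f g : ℤ⟦X⟧} (hf : constantCoeff f = 1)
    (hg : constantCoeff g = 1)
    (h : f ^ 2 * expand 2 two_ne_zero g = g ^ 2 * expand 2 two_ne_zero f) : f = g := by
  obtain ⟨i, hi, hi0⟩ := exists_mul_eq_one hg
  have hi2 := congrArg (expand 2 two_ne_zero) hi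
  rw [map_mul, map_one] at hi2
  have : f * i = 1 := by
    refine eq_one_of_sq_eq_expand (by simp [hf, hi0]) ?_
    rw [map_mul]
    linear_combination i ^ 2 * expand 2 two_ne_zero i * h - f ^ 2 * i ^ 2 * hi2
      + expand 2 two_ne_zero f * expand 2 two_ne_zero i * (g * i + 1) * hi
  linear_combination g * this - f * hi

/-! ### Constant coefficients and product formulas -/

theorem constantCoeff_series_quad {a b : ℕ} (h : b < a) (w : ℤ → ℤ) :
    constantCoeff (series (quad a b) w) = w 0 := by
  rw [← coeff_zero_eq_constantCoeff_apply, coeff_series]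
  have : quad a b ⁻¹' {0} = {0} := by
    ext n
    simp only [Set.mem_preimage, Set.mem_singleton_iff]
    constructor
    · intro hn
      have := natAbs_le_quad h n
      rw [hn] at this
      simpa using this
    · rintro rfl
      simp [quad]
  rw [this, finsum_mem_singleton]

@[simp]
theorem constantCoeff_phi : constantCoeff phi = 1 := constantCoeff_series_quad (by norm_num) _

@[simp]
theorem constantCoeff_phiNeg : constantCoeff phiNeg = 1 := by
  rw [phiNeg, constantCoeff_series_quad (by norm_num)]; rfl

@[simp]
theorem constantCoeff_psi : constantCoeff psi = 1 := constantCoeff_series_quad (by norm_num) _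

@[simp]
theorem constantCoeff_psiNeg : constantCoeff psiNeg = 1 := by
  rw [psiNeg, constantCoeff_series_quad (by norm_num)]; rfl

@[simp]
theorem constantCoeff_euler : constantCoeff euler = 1 := by
  have h := X_pow_dvd_iff.mp (X_pow_dvd_euler_sub_poch 0) 0 one_pos
  rw [map_sub, sub_eq_zero] at h
  simpa [poch] using h

/-- By `psi_sq`, `phi_mul_phiNeg` and Gauss's product, the quotient `r` of the two sides satisfies
`r(q)^2 = r(q^2)`, so it is 1. -/
theorem psi_mul_euler : psi * euler = (expand 2 two_ne_zero euler) ^ 2 := by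
  refine eq_of_sq_mul_expand_eq (by simp) (by simp) ?_
  have h4 := expand_comp two_ne_zero two_ne_zero four_ne_zero rfl euler
  have g2 := congrArg (expand 2 two_ne_zero) phiNeg_mul_euler
  simp only [map_mul, map_pow] at g2 ⊢
  rw [h4] at g2 ⊢
  set p2 := expand 2 two_ne_zero psi
  set f2 := expand 2 two_ne_zero euler
  set f4 := expand 4 four_ne_zero euler
  set m2 := expand 2 two_ne_zero phiNeg
  have h1 := phi_mul_phiNeg
  have h2 := psi_sq
  have h3 := phiNeg_mul_euler
  linear_combination euler ^ 2 * f4 ^ 2 * h2 - phi * p2 * f4 ^ 2 * h3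
    + f2 * p2 * f4 ^ 2 * h1 + f2 * p2 * (m2 * f4 + f2 ^ 2) * g2

/-- The quotient of the two sides is invariant under `q ↦ q^2`, hence equals 1. -/
theorem psiNeg_mul_phiNeg : psiNeg * expand 2 two_ne_zero phiNeg = psi * phiNeg := by
  refine eq_of_mul_expand_eq (by simp) (by simp) ?_
  have h4 := expand_comp two_ne_zero two_ne_zero four_ne_zero rfl phiNeg
  have hne : psi * expand 2 two_ne_zero phiNeg ≠ 0 := ne_zero_of_constantCoeff (by simp)
  apply mul_left_cancel₀ hne
  simp only [map_mul, h4]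
  have h1 := phi_mul_phiNeg
  have h2 := psi_sq
  have h3 := psi_mul_psiNeg
  set m2 := expand 2 two_ne_zero phiNeg
  set m4 := expand 4 four_ne_zero phiNeg
  set p2 := expand 2 two_ne_zero psi
  set n2 := expand 2 two_ne_zero psiNeg
  linear_combination m2 ^ 3 * p2 * h3 - m2 * n2 * m4 * phiNeg * h2 - m2 * n2 * m4 * p2 * h1

/-! ### Congruences -/

theorem two_dvd_of_map_eq {f g : ℤ⟦X⟧} (h : PowerSeries.map (Int.castRingHom (ZMod 2)) f =
    PowerSeries.map (Int.castRingHom (ZMod 2)) g) : ∃ u, f = g + 2 * u := by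
  refine ⟨PowerSeries.mk fun n => (coeff n f - coeff n g) / 2, ?_⟩
  ext n
  have h1 := congrArg (coeff n) h
  simp only [coeff_map, eq_intCast] at h1
  have h2 := (ZMod.intCast_eq_intCast_iff_dvd_sub _ _ 2).mp h1.symm
  rw [map_add, two_mul, map_add, coeff_mk]
  push_cast at h2
  omega

/-- Modulo 2, `phi_eq_two` reads `φ(q) ≡ φ(q^4)`, and rigidity applies. -/
theorem phi_modEq_one : ∃ u, phi = 1 + 2 * u := by
  apply two_dvd_of_map_eq
  rw [map_one]
  refine eq_one_of_eq_expand (k := 4) (by norm_num) ?_ ?_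
  · rw [← coeff_zero_eq_constantCoeff_apply, coeff_map, coeff_zero_eq_constantCoeff_apply]
    simp
  have h2 : (2 : (ZMod 2)⟦X⟧) = 0 := by
    rw [← map_ofNat (C (R := ZMod 2)), show (OfNat.ofNat 2 : ZMod 2) = 0 from rfl, map_zero]
  conv_lhs => rw [phi_eq_two]
  rw [map_add, map_mul, map_mul, map_expand, map_ofNat, h2]
  ring

theorem phiNeg_modEq_one : ∃ u, phiNeg = 1 + 2 * u := by
  obtain ⟨u, hu⟩ := phi_modEq_one
  have h1 := phi_eq_two
  have h2 := phiNeg_eq_two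
  exact ⟨u - 2 * X * expand 8 (by norm_num) psi, by linear_combination hu + h2 - h1⟩

theorem phiNeg_sq_modEq_one : ∃ u, phiNeg ^ 2 = 1 + 4 * u := by
  obtain ⟨u, hu⟩ := phiNeg_modEq_one
  exact ⟨u + u ^ 2, by rw [hu]; ring⟩

/-- Modulo 4, `φ(q) f_1^2 ≡ φ(-q) f_1^2 = φ(-q)^2 f_2 ≡ f_2`; then `q ↦ q^2`. -/
theorem expand_phi_mul_euler_modEq : ∃ u,
    expand 2 two_ne_zero phi * expand 2 two_ne_zero (euler ^ 2) =
      expand 4 four_ne_zero euler + 4 * u := by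
  obtain ⟨u, hu⟩ := phiNeg_sq_modEq_one
  have h1 := phi_eq_two
  have h2 := phiNeg_eq_two
  have h3 := phiNeg_mul_euler
  have : phi * euler ^ 2 = expand 2 two_ne_zero euler +
      4 * (X * expand 8 (by norm_num) psi * euler ^ 2 + u * expand 2 two_ne_zero euler) := by
    linear_combination euler ^ 2 * (h1 - h2) - phiNeg * h3 + expand 2 two_ne_zero euler * hu
  have h5 := congrArg (expand 2 two_ne_zero) this
  rw [map_mul, map_add, map_mul (expand 2 two_ne_zero) 4, map_ofNat,
    expand_comp two_ne_zero two_ne_zero four_ne_zero rfl] at h5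
  exact ⟨_, h5⟩

/-- Modulo 2, `f_1^2 ≡ f_2`, so `ψ(q^4) f_2^2 ≡ ψ(q^4) f_4 = f_8^2 ≡ f_16`. -/
theorem expand_psi_mul_euler_modEq : ∃ u,
    expand 4 four_ne_zero psi * expand 2 two_ne_zero (euler ^ 2) =
      expand 16 (by norm_num) euler + 2 * u := by
  obtain ⟨u, hu⟩ := phiNeg_modEq_one
  have h3 := phiNeg_mul_euler
  have h4 := psi_mul_euler
  have sq2 : ∃ v, euler ^ 2 = expand 2 two_ne_zero euler + 2 * v :=
    ⟨u * expand 2 two_ne_zero euler, by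
      linear_combination expand 2 two_ne_zero euler * hu - h3⟩
  obtain ⟨v, hv⟩ := sq2
  have hv2 := congrArg (expand 2 two_ne_zero) hv
  rw [map_add, map_mul (expand 2 two_ne_zero) 2, map_ofNat,
    expand_comp two_ne_zero two_ne_zero four_ne_zero rfl] at hv2
  have h5 := congrArg (expand 4 four_ne_zero) h4
  rw [← map_pow, hv2, map_mul, map_add, map_mul (expand 4 four_ne_zero) 2, map_ofNat,
    expand_comp four_ne_zero four_ne_zero (show 16 ≠ 0 by norm_num) rfl] at h5
  refine ⟨expand 4 four_ne_zero psi * expand 2 two_ne_zero v +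
    expand 4 four_ne_zero (expand 2 two_ne_zero v), ?_⟩
  rw [hv2]
  linear_combination h5

/-! ### Dissection of the generating function -/

theorem dissect_two_mul (k r : ℕ) (f : ℤ⟦X⟧) : dissect k r (2 * f) = 2 * dissect k r f := by
  rw [two_mul, map_add, two_mul]

theorem dissect_C_mul (k r : ℕ) (c : ℤ) (f : ℤ⟦X⟧) :
    dissect k r (C c * f) = C c * dissect k r f := by
  ext n
  simp only [coeff_dissect, coeff_C_mul]

/-- The functional equation `F(q) * φ(-q) * φ(-q ^ 6) = φ(-q ^ 2) * φ(-q ^ 3)`, which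
characterizes the generating function of `3`-Schur overpartitions. -/
def IsSchurSeries (F : ℤ⟦X⟧) : Prop :=
  F * (phiNeg * expand 6 (by norm_num) phiNeg) =
    expand 2 two_ne_zero phiNeg * expand 3 three_ne_zero phiNeg

theorem mul_expand_eq_phi_mul_phiNeg {F : ℤ⟦X⟧} (hF : IsSchurSeries F) :
    F * (expand 2 two_ne_zero phiNeg * expand 6 (by norm_num) phiNeg) =
      phi * expand 3 three_ne_zero phiNeg := by
  have hne : expand 2 two_ne_zero phiNeg ≠ 0 := ne_zero_of_constantCoeff (by simp)
  apply mul_left_cancel₀ hne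
  rw [IsSchurSeries] at hF
  linear_combination phi * hF - F * expand 6 (by norm_num) phiNeg * phi_mul_phiNeg

/-- The odd part first comes out in terms of `ψ(-q) ψ(-q^3)`; `psiNeg_mul_phiNeg` at `q` and `q^3`
moves the denominator to even powers of `q`, ready for the next dissection. -/
theorem dissect_two_one_mul {F : ℤ⟦X⟧} (hF : IsSchurSeries F) :
    dissect 2 1 F * (expand 2 two_ne_zero phiNeg * expand 6 (by norm_num) phiNeg) =
      2 * (psi * expand 3 three_ne_zero psi) := by
  have h := congrArg (dissect 2 1) (mul_expand_eq_phi_mul_phiNeg hF)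
  rw [dissect_phi_mul_phiNeg_three,
    ← expand_comp two_ne_zero three_ne_zero (show 6 ≠ 0 by norm_num) rfl, ← map_mul,
    dissect_mul_expand two_ne_zero one_lt_two] at h
  have h1 := psiNeg_mul_phiNeg
  have h3 := congrArg (expand 3 three_ne_zero) h1
  rw [map_mul, map_mul, expand_comp three_ne_zero two_ne_zero (show 6 ≠ 0 by norm_num) rfl] at h3
  have hne : phiNeg * expand 3 three_ne_zero phiNeg ≠ 0 := ne_zero_of_constantCoeff (by simp)
  apply mul_left_cancel₀ hne
  linear_combination expand 2 two_ne_zero phiNeg * expand 6 (by norm_num) phiNeg * h +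
    2 * expand 3 three_ne_zero psiNeg * expand 6 (by norm_num) phiNeg * h1 +
    2 * psi * phiNeg * h3

theorem dissect_four_three_mul {F : ℤ⟦X⟧} (hF : IsSchurSeries F) :
    dissect 2 1 (dissect 2 1 F) * (phiNeg * expand 3 three_ne_zero phiNeg) =
      2 * (expand 6 (by norm_num) psi * phi) := by
  have h := congrArg (dissect 2 1) (dissect_two_one_mul hF)
  rwa [dissect_two_mul, dissect_psi_mul_psi_three,
    ← expand_comp two_ne_zero three_ne_zero (show 6 ≠ 0 by norm_num) rfl, ← map_mul,
    dissect_mul_expand two_ne_zero one_lt_two] at h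

theorem dissect_twelve_seven_mul {F : ℤ⟦X⟧} (hF : IsSchurSeries F) :
    dissect 3 1 (dissect 2 1 (dissect 2 1 F)) * (phiNeg *
      ((expand 3 three_ne_zero phiNeg) ^ 3 - 8 * X * omgNeg ^ 3)) =
      8 * (expand 2 two_ne_zero psi * expand 3 three_ne_zero phiNeg *
        expand 4 four_ne_zero (euler ^ 2)) := by
  set H := dissect 2 1 (dissect 2 1 F) with hH
  set a := expand 3 three_ne_zero phi with ha
  set a' := expand 3 three_ne_zero phiNeg with ha'
  set p2 := expand 2 two_ne_zero psi with hp2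
  have h := dissect_four_three_mul hF
  rw [← hH] at h
  have h1 := phi_eq_three
  have h2 := phiNeg_eq_three
  rw [← expand_comp three_ne_zero three_ne_zero (show 9 ≠ 0 by norm_num) rfl] at h1 h2
  rw [← expand_comp three_ne_zero two_ne_zero (show 6 ≠ 0 by norm_num) rfl] at h
  rw [← ha] at h1
  rw [← ha'] at h2 h
  rw [← hp2] at h
  let E : ℤ⟦X⟧ →ₐ[ℤ] ℤ⟦X⟧ := expand 3 three_ne_zero
  -- With `φ(-q) = A - B`, multiplying by `A^2 + AB + B^2` turns this denominator into `A^3 - B^3`,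
  -- a series in `q^3`. The right side is sorted by exponents modulo 3.
  have key : H * E (phiNeg * (a' ^ 3 - 8 * X * omgNeg ^ 3)) =
      X ^ 0 * E (2 * (p2 * (a * a' ^ 2 + 8 * X * omg * omgNeg ^ 2))) +
      X ^ 1 * E (2 * (p2 * (2 * a * a' * omgNeg + 2 * omg * a' ^ 2))) +
      X ^ 2 * E (2 * (p2 * (4 * a * omgNeg ^ 2 + 4 * omg * a' * omgNeg))) := by
    have hX : E X = X ^ 3 := expand_X 3 three_ne_zero
    simp only [map_mul, map_add, map_sub, map_pow, map_ofNat, hX]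
    change H * (a' * (E a' ^ 3 - 8 * X ^ 3 * E omgNeg ^ 3)) = _
    change phi = E a + 2 * X * E omg at h1
    change phiNeg = E a' - 2 * X * E omgNeg at h2
    change H * (phiNeg * a') = 2 * (E p2 * phi) at h
    rw [h1, h2] at h
    linear_combination (E a' ^ 2 + 2 * X * E a' * E omgNeg + 4 * X ^ 2 * E omgNeg ^ 2) * h
  have h5 := congrArg (dissect 3 1) key
  simp only [map_add] at h5
  rw [dissect_mul_expand three_ne_zero (by norm_num),
    dissect_X_pow_mul_expand three_ne_zero (by norm_num) (by norm_num),
    dissect_X_pow_mul_expand three_ne_zero (by norm_num) (by norm_num),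
    dissect_X_pow_mul_expand three_ne_zero (by norm_num) (by norm_num)] at h5
  norm_num at h5
  have h6 := phi_mul_omgNeg_add_phiNeg_mul_omg
  rw [← ha, ← ha'] at h6
  linear_combination h5 + 4 * p2 * a' * h6

theorem exists_dissect_twelve_seven_eq {F : ℤ⟦X⟧} (hF : IsSchurSeries F) : ∃ K : ℤ⟦X⟧,
    dissect 3 1 (dissect 2 1 (dissect 2 1 F)) = 8 * K ∧
    ∃ u, K = expand 2 two_ne_zero psi * (X ^ 0 * expand 2 two_ne_zero
        (expand 2 two_ne_zero phi * expand 2 two_ne_zero (euler ^ 2))) -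
      2 * (expand 2 two_ne_zero psi * (X ^ 1 * expand 2 two_ne_zero
        (expand 4 four_ne_zero psi * expand 2 two_ne_zero (euler ^ 2)))) + 2 * (2 * u) := by
  have h := dissect_twelve_seven_mul hF
  set a := expand 3 three_ne_zero phiNeg
  set p2 := expand 2 two_ne_zero psi
  set f := expand 4 four_ne_zero (euler ^ 2)
  set L := dissect 3 1 (dissect 2 1 (dissect 2 1 F))
  obtain ⟨i, hi, -⟩ := exists_mul_eq_one (f := phiNeg * (a ^ 3 - 8 * X * omgNeg ^ 3)) (by simp [a])
  obtain ⟨s, hs⟩ := phiNeg_sq_modEq_one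
  obtain ⟨t, ht⟩ : ∃ t, a ^ 2 = 1 + 4 * t := by
    refine ⟨expand 3 three_ne_zero s, ?_⟩
    have := congrArg (expand 3 three_ne_zero) hs
    rwa [map_pow, map_add, map_one, map_mul, map_ofNat] at this
  refine ⟨p2 * a * f * i, ?_, ?_⟩
  · linear_combination i * h - L * hi
  · set K := p2 * a * f * i with hK
    have hK' : K * (phiNeg * (a ^ 3 - 8 * X * omgNeg ^ 3)) = p2 * a * f := by
      linear_combination p2 * a * f * hi
    have e : expand 2 two_ne_zero (expand 4 four_ne_zero psi * expand 2 two_ne_zero (euler ^ 2)) =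
        expand 8 (by norm_num) psi * f := by
      rw [map_mul, expand_comp _ _ (show 8 ≠ 0 by norm_num) rfl, expand_comp _ _ four_ne_zero rfl]
    have e' : expand 2 two_ne_zero (expand 2 two_ne_zero phi * expand 2 two_ne_zero (euler ^ 2)) =
        expand 4 four_ne_zero phi * f := by
      rw [map_mul, expand_comp _ _ four_ne_zero rfl, expand_comp _ _ four_ne_zero rfl]
    rw [e, e']
    -- Modulo 4 the squares of `phiNeg` and `a` are 1, so `K ≡ p2 * f * phiNeg`; `phiNeg_eq_two`
    -- then separates even and odd exponents.
    refine ⟨p2 * phiNeg * f * t - K * s * (1 + 4 * t) ^ 2 - K * (2 * t + 4 * t ^ 2)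
      + K * 2 * X * omgNeg ^ 3 * phiNeg ^ 2 * a, ?_⟩
    linear_combination phiNeg * a * hK' - K * a ^ 4 * hs
      - K * (1 + 4 * s) * (a ^ 2 + 1 + 4 * t) * ht + p2 * phiNeg * f * ht
      + p2 * f * phiNeg_eq_two

theorem coeff_twelve_mul_add_seven (F : ℤ⟦X⟧) (n : ℕ) :
    coeff (12 * n + 7) F = coeff n (dissect 3 1 (dissect 2 1 (dissect 2 1 F))) := by
  simp only [coeff_dissect]
  congr 2
  omega

theorem thirtyTwo_dvd_coeff_seven {F : ℤ⟦X⟧} (hF : IsSchurSeries F) {M : ℕ}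
    (h : ∀ x y : ℤ, 3 * x ^ 2 + y ^ 2 ≠ (24 * M + 7 : ℕ)) : 32 ∣ coeff (24 * M + 7) F := by
  obtain ⟨K, hK, u, hu⟩ := exists_dissect_twelve_seven_eq hF
  obtain ⟨v, hv⟩ := expand_phi_mul_euler_modEq
  have h0 : dissect 2 0 K = psi * expand 4 four_ne_zero euler +
      4 * (psi * v + dissect 2 0 u) := by
    rw [hu]
    simp only [map_add, map_sub, dissect_two_mul]
    rw [dissect_expand_mul _ two_pos, dissect_expand_mul _ two_pos,
      dissect_X_pow_mul_expand _ two_pos two_pos, dissect_X_pow_mul_expand _ two_pos one_lt_two]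
    norm_num
    rw [← map_pow, hv]
    ring
  have hz : coeff M (psi * expand 4 four_ne_zero euler) = 0 := by
    rw [psi, euler, expand_series, series_mul _ _ finiteFibers_quad_two_one
      (finiteFibers_pentagonal.const_mul four_ne_zero)]
    refine coeff_series_eq_zero ?_
    rintro ⟨k, l⟩ hkl
    -- Completing squares: `24(2k^2 + k) + 3 = 3(4k + 1)^2`, and 96 times the pentagonal number of
    -- `l`, plus 4, is `4(6l - 1)^2`.
    refine h (4 * k + 1) (2 * (6 * l - 1)) ?_
    zify at hkl
    rw [quad_two_one] at hkl
    push_cast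
    linear_combination 24 * hkl - 48 * two_mul_natCast_pentagonal l
  rw [show 24 * M + 7 = 12 * (2 * M + 0) + 7 by ring, coeff_twelve_mul_add_seven, hK,
    ← coeff_dissect, show (8 : ℤ⟦X⟧) = C 8 by simp,
    dissect_C_mul, coeff_C_mul, h0, map_add, hz,
    show (4 : ℤ⟦X⟧) = C 4 by simp, coeff_C_mul, zero_add]
  exact ⟨_, by ring⟩

theorem thirtyTwo_dvd_coeff_nineteen {F : ℤ⟦X⟧} (hF : IsSchurSeries F) {M : ℕ}
    (h : ∀ x y : ℤ, 3 * x ^ 2 + y ^ 2 ≠ (24 * M + 19 : ℕ)) : 32 ∣ coeff (24 * M + 19) F := by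
  obtain ⟨K, hK, u, hu⟩ := exists_dissect_twelve_seven_eq hF
  obtain ⟨v, hv⟩ := expand_psi_mul_euler_modEq
  have h0 : dissect 2 1 K = -2 * (psi * expand 16 (by norm_num) euler) +
      4 * (dissect 2 1 u - psi * v) := by
    rw [hu]
    simp only [map_add, map_sub, dissect_two_mul]
    rw [dissect_expand_mul _ one_lt_two, dissect_expand_mul _ one_lt_two,
      dissect_X_pow_mul_expand _ one_lt_two two_pos,
      dissect_X_pow_mul_expand _ one_lt_two one_lt_two]
    norm_num
    rw [← map_pow, hv]
    ring
  have hz : coeff M (psi * expand 16 (by norm_num) euler) = 0 := by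
    rw [psi, euler, expand_series, series_mul _ _ finiteFibers_quad_two_one
      (finiteFibers_pentagonal.const_mul (by norm_num))]
    refine coeff_series_eq_zero ?_
    rintro ⟨k, l⟩ hkl
    -- As for residue 7, with `q^16` in place of `q^4`: the constants are now `3 + 16 = 19`.
    refine h (4 * k + 1) (4 * (6 * l - 1)) ?_
    zify at hkl
    rw [quad_two_one] at hkl
    push_cast
    linear_combination 24 * hkl - 192 * two_mul_natCast_pentagonal l
  rw [show 24 * M + 19 = 12 * (2 * M + 1) + 7 by ring, coeff_twelve_mul_add_seven, hK,
    ← coeff_dissect, show (8 : ℤ⟦X⟧) = C 8 by simp,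
    dissect_C_mul, coeff_C_mul, h0, map_add,
    show (-2 : ℤ⟦X⟧) = C (-2) by simp, coeff_C_mul, hz,
    show (4 : ℤ⟦X⟧) = C 4 by simp, coeff_C_mul, mul_zero, zero_add]
  exact ⟨_, by ring⟩

theorem generatingFunction_modEq_one {F : ℤ⟦X⟧} (hF : IsSchurSeries F) : ∃ u, F = 1 + 2 * u := by
  have h := mul_expand_eq_phi_mul_phiNeg hF
  obtain ⟨u, hu⟩ := phi_modEq_one
  obtain ⟨v, hv⟩ := phiNeg_modEq_one
  have hv' : ∀ (k : ℕ) (hk : k ≠ 0), expand k hk phiNeg = 1 + 2 * expand k hk v := by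
    intro k hk
    have := congrArg (expand k hk) hv
    rwa [map_add, map_one, map_mul, map_ofNat] at this
  rw [hv', hv', hv', hu] at h
  exact ⟨u + expand 3 three_ne_zero v + 2 * u * expand 3 three_ne_zero v -
    F * (expand 2 two_ne_zero v + expand 6 (by norm_num) v +
      2 * expand 2 two_ne_zero v * expand 6 (by norm_num) v), by linear_combination h⟩

/-- Each squaring of a series that is 1 modulo `2^k` gains a factor 2: `F^2`, `F^4`, `F^8`, `F^16`
are 1 modulo 4, 8, 16, 32. -/
theorem generatingFunction_pow_modEq {F : ℤ⟦X⟧} (hF : IsSchurSeries F) (m : ℕ) :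
    ∃ u, F ^ (16 * m + 1) = F + 32 * u := by
  obtain ⟨u, hu⟩ := generatingFunction_modEq_one hF
  have h2 : F ^ 2 = 1 + 4 * (u + u ^ 2) := by rw [hu]; ring
  obtain ⟨c, h16⟩ : ∃ c, F ^ 16 = 1 + 32 * c := by
    set a := u + u ^ 2
    set b := a + 2 * a ^ 2
    set c := b + 4 * b ^ 2
    have h4 : F ^ 4 = 1 + 8 * b := by linear_combination (F ^ 2 + 1 + 4 * a) * h2
    have h8 : F ^ 8 = 1 + 16 * c := by linear_combination (F ^ 4 + 1 + 8 * b) * h4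
    exact ⟨c + 8 * c ^ 2, by linear_combination (F ^ 8 + 1 + 16 * c) * h8⟩
  have hm : (32 : ℤ⟦X⟧) ∣ (F ^ 16) ^ m - 1 := by
    refine dvd_trans ⟨c, by rw [h16]; ring⟩ (sub_one_dvd_pow_sub_one (F ^ 16) m)
  obtain ⟨d, hd⟩ := hm
  exact ⟨F * d, by rw [pow_succ, pow_mul]; linear_combination F * hd⟩

theorem thirtyTwo_dvd_coeff_pow_nineteen {F : ℤ⟦X⟧} (hF : IsSchurSeries F) (m : ℕ) {M : ℕ}
    (h : ∀ x y : ℤ, 3 * x ^ 2 + y ^ 2 ≠ (24 * M + 19 : ℕ)) :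
    32 ∣ coeff (24 * M + 19) (F ^ (16 * m + 1)) := by
  obtain ⟨u, hu⟩ := generatingFunction_pow_modEq hF m
  rw [hu, map_add, show (32 : ℤ⟦X⟧) = C 32 by simp, coeff_C_mul]
  exact dvd_add (thirtyTwo_dvd_coeff_nineteen hF h) (dvd_mul_right _ _)

/-! ### Products over sets of exponents -/

section Product

open scoped PowerSeries.WithPiTopology
open PowerSeries.WithPiTopology Filter

theorem hasProd_expand {k : ℕ} (hk : k ≠ 0) {g : ℕ → ℤ⟦X⟧} {a : ℤ⟦X⟧} (h : HasProd g a) :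
    HasProd (fun i => expand k hk (g i)) (expand k hk a) := by
  rw [HasProd, tendsto_iff_coeff_tendsto] at h ⊢
  intro d
  simp only [← map_prod, coeff_expand]
  split_ifs
  · exact h _
  · exact tendsto_const_nhds

/-- The factor `1 - q ^ n` if `n` belongs to `S`, and `1` otherwise. -/
noncomputable def factor (S : ℕ → Prop) [DecidablePred S] (n : ℕ) : ℤ⟦X⟧ :=
  if S n then 1 - X ^ n else 1

/-- The product `∏ (1 - q ^ n)` over the positive elements of `S`. -/
noncomputable def prodOn (S : ℕ → Prop) [DecidablePred S] : ℤ⟦X⟧ := ∏' i, factor S (i + 1)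

theorem hasProd_prodOn (S : ℕ → Prop) [DecidablePred S] :
    HasProd (fun i => factor S (i + 1)) (prodOn S) := by
  apply Multipliable.hasProd
  have : (fun i => factor S (i + 1)) = (1 + (fun i => if S (i + 1) then -X ^ (i + 1) else 0) ·) := by
    ext1 i
    by_cases h : S (i + 1) <;> simp [factor, h, sub_eq_add_neg]
  rw [this]
  apply multipliable_one_add_of_tendsto_order_atTop_nhds_top
  refine ENat.tendsto_nhds_top_iff_natCast_lt.mpr fun n => eventually_atTop.mpr ⟨n, ?_⟩
  intro m hm
  split_ifs
  · rw [order_neg, order_X_pow]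
    exact_mod_cast Nat.lt_succ_of_le hm
  · simp

theorem prodOn_mul_prodOn (S T U : ℕ → Prop) [DecidablePred S] [DecidablePred T]
    [DecidablePred U] (hU : ∀ n, U n ↔ S n ∨ T n) (hdisj : ∀ n, S n → ¬ T n) :
    prodOn S * prodOn T = prodOn U := by
  refine ((hasProd_prodOn S).mul (hasProd_prodOn T)).unique ?_
  convert hasProd_prodOn U using 2 with i
  have h1 := hU (i + 1)
  have h2 := hdisj (i + 1)
  simp only [factor]
  by_cases hS : S (i + 1)
  · simp [h1, hS, h2 hS]
  · by_cases hT : T (i + 1) <;> simp [h1, hS, hT]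

theorem expand_prodOn {k : ℕ} (hk : k ≠ 0) (S T : ℕ → Prop) [DecidablePred S] [DecidablePred T]
    (h : ∀ j, T (k * j) ↔ S j) (hdvd : ∀ n, T n → k ∣ n) :
    expand k hk (prodOn S) = prodOn T := by
  refine (hasProd_expand hk (hasProd_prodOn S)).unique ?_
  have hinj : Function.Injective fun i : ℕ => k * (i + 1) - 1 := by
    intro a b hab
    have ha : 0 < k * (a + 1) := by positivity
    have hb : 0 < k * (b + 1) := by positivity
    have : k * (a + 1) = k * (b + 1) := by simp only at hab; omega
    simpa [hk] using this
  have := (hinj.hasProd_iff (f := fun i => factor T (i + 1)) (a := prodOn T) ?_).mpr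
    (hasProd_prodOn T)
  · convert this using 2 with i
    have hp : 0 < k * (i + 1) := by positivity
    rw [Function.comp_apply, Nat.sub_add_cancel hp, factor, factor]
    simp only [h]
    split_ifs
    · rw [map_sub, map_one, map_pow, expand_X, pow_mul]
    · simp
  · intro n hn
    rw [factor, if_neg]
    intro hT
    obtain ⟨c, hc⟩ := hdvd _ hT
    refine hn ⟨c - 1, ?_⟩
    have : 0 < c := by
      rcases Nat.eq_zero_or_pos c with rfl | h
      · omega
      · exact h
    simp only
    rw [Nat.sub_add_cancel this, ← hc]
    omega

theorem euler_eq_prodOn : euler = prodOn fun _ => True := by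
  rw [euler_eq_pentagonalSeries]
  refine (hasProd_one_sub_X_pow ℤ).unique ?_
  simpa [factor] using hasProd_prodOn fun _ => True

/-- Multiplying the generating function of overpartitions with parts in `S` by
`∏ (1 - q ^ n) ^ 2`. -/
theorem genFun_mul_prodOn_sq (S : ℕ → Prop) [DecidablePred S] :
    Nat.Partition.genFun (fun i _ => if S i then (2 : ℤ) else 0) * prodOn S ^ 2 =
      expand 2 two_ne_zero (prodOn S) := by
  rw [sq]
  refine ((Nat.Partition.hasProd_genFun _).mul
    ((hasProd_prodOn S).mul (hasProd_prodOn S))).unique ?_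
  convert hasProd_expand two_ne_zero (hasProd_prodOn S) using 2 with i
  · rfl
  simp only [factor, smul_eq_C_mul]
  split_ifs with h
  -- A part size contributes `1 + 2y/(1 - y) = (1 + y)/(1 - y)`, which `(1 - y)^2` turns into `1 -
  -- y^2`.
  · have hc : constantCoeff (X ^ (i + 1) : ℤ⟦X⟧) = 0 := by simp
    have h1 := tsum_pow_mul_one_sub_of_constantCoeff_eq_zero hc
    have hs := summable_pow_of_constantCoeff_eq_zero hc
    have h2 : ∑' j : ℕ, C (2 : ℤ) * (X : ℤ⟦X⟧) ^ ((i + 1) * (j + 1)) =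
        2 * X ^ (i + 1) * ∑' j : ℕ, (X ^ (i + 1)) ^ j := by
      rw [← hs.tsum_mul_left]
      congr 1
      ext1 j
      rw [pow_mul, pow_succ, show C (2 : ℤ) = (2 : ℤ⟦X⟧) by simp]
      ring
    rw [h2, map_sub, map_one, map_pow, expand_X]
    set y : ℤ⟦X⟧ := X ^ (i + 1) with hy
    have : (X ^ 2 : ℤ⟦X⟧) ^ (i + 1) = y ^ 2 := by rw [hy, ← pow_mul, ← pow_mul, mul_comm]
    rw [this]
    linear_combination 2 * y * (1 - y) * h1
  · simp

end Product

/-! ### The generating function of `3`-Schur overpartitions -/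

theorem schurOverpartitionCount_eq_sum (t n : ℕ) :
    schurOverpartitionCount t n = ∑ p : n.Partition,
      if ∀ i ∈ p.parts, i % (2 * t) ∈ schurResidues t then 2 ^ p.parts.toFinset.card else 0 := by
  let e : SchurOverpartition t n ≃ Σ p : {p : n.Partition // ∀ i ∈ p.parts,
      i % (2 * t) ∈ schurResidues t}, p.1.parts.toFinset.powerset :=
    { toFun := fun P => ⟨⟨P.partition, P.residue_mem⟩,
        ⟨P.overlined, Finset.mem_powerset.mpr P.overlined_subset⟩⟩
      invFun := fun P => ⟨P.1.1, P.1.2, P.2.1, Finset.mem_powerset.mp P.2.2⟩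
      left_inv := fun _ => rfl
      right_inv := fun _ => rfl }
  rw [schurOverpartitionCount, Nat.card_congr e, Nat.card_sigma, ← Finset.sum_filter]
  simp only [Nat.card_eq_fintype_card, Fintype.card_coe, Finset.card_powerset]
  symm
  exact Finset.sum_subtype _ (by simp) fun p : n.Partition => 2 ^ p.parts.toFinset.card

theorem coeff_genFun_eq_schurOverpartitionCount (t n : ℕ) :
    coeff n (Nat.Partition.genFun
      fun i _ => if i % (2 * t) ∈ schurResidues t then (2 : ℤ) else 0) =
      schurOverpartitionCount t n := by
  rw [Nat.Partition.coeff_genFun, schurOverpartitionCount_eq_sum]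
  push_cast
  refine Finset.sum_congr rfl fun p _ => ?_
  rw [Finsupp.prod, Finset.prod_ite_zero, Finset.prod_const]
  simp

/-- With `c` the product over admissible parts and `d` the product over odd numbers, `F =
c(q^2)/c(q)^2`, `d(q) = c(q) d(q^3)`, `f_1 = d f_2` and `φ(-q) = d^2 f_2`. The functional equation
follows by elimination. -/
theorem isSchurSeries_genFun :
    IsSchurSeries (Nat.Partition.genFun
      fun i _ => if i % (2 * 3) ∈ schurResidues 3 then (2 : ℤ) else 0) := by
  set F := Nat.Partition.genFun
      fun i _ => if i % (2 * 3) ∈ schurResidues 3 then (2 : ℤ) else 0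
  have hmem : ∀ i : ℕ, i % (2 * 3) ∈ schurResidues 3 ↔ i % 2 = 1 ∧ i % 3 ≠ 0 := by
    intro i
    simp only [schurResidues, Finset.mem_filter, Finset.mem_range, Nat.odd_iff]
    omega
  set c := prodOn fun i => i % (2 * 3) ∈ schurResidues 3
  set d := prodOn fun i => i % 2 = 1
  set f := euler
  have hF : F * c ^ 2 = expand 2 two_ne_zero c := genFun_mul_prodOn_sq _
  have hd : d = c * expand 3 three_ne_zero d := by
    rw [expand_prodOn three_ne_zero (fun i => i % 2 = 1) (fun i => i % 6 = 3)
      (fun j => by omega) (fun j hj => by omega)]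
    exact (prodOn_mul_prodOn _ _ _ (fun n => by simp only [hmem]; omega)
      (fun n => by simp only [hmem]; omega)).symm
  have hf : f = d * expand 2 two_ne_zero f := by
    have h2 : expand 2 two_ne_zero f = prodOn fun i => i % 2 = 0 := by
      rw [show f = _ from euler_eq_prodOn]
      exact expand_prodOn two_ne_zero _ _ (fun j => by simp) (fun j hj => by omega)
    rw [h2, show f = _ from euler_eq_prodOn]
    exact (prodOn_mul_prodOn _ _ _ (fun n => ⟨fun _ => by omega, fun _ => trivial⟩)
      (fun n => by omega)).symm
  have hg : phiNeg = d ^ 2 * expand 2 two_ne_zero f := by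
    have hne : expand 2 two_ne_zero f ≠ 0 := ne_zero_of_constantCoeff (by simp [f])
    apply mul_right_cancel₀ hne
    have := phiNeg_mul_euler
    change phiNeg * expand 2 two_ne_zero f = f ^ 2 at this
    linear_combination this + (f + d * expand 2 two_ne_zero f) * hf
  have lift : ∀ (k l : ℕ) (hk : k ≠ 0) (hl : l ≠ 0), k * 2 = l → expand k hk phiNeg =
      (expand k hk d) ^ 2 * expand l hl f := by
    intro k l hk hl h
    have := congrArg (expand k hk) hg
    rwa [map_mul, map_pow, expand_comp hk two_ne_zero hl h] at this
  have hd2 := congrArg (expand 2 two_ne_zero) hd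
  rw [map_mul, expand_comp _ _ (show 6 ≠ 0 by norm_num) rfl] at hd2
  have hf2 := congrArg (expand 2 two_ne_zero) hf
  rw [map_mul, expand_comp _ _ four_ne_zero rfl] at hf2
  have hf6 := congrArg (expand 6 (by norm_num)) hf
  rw [map_mul, expand_comp _ _ (show 12 ≠ 0 by norm_num) rfl] at hf6
  rw [IsSchurSeries, lift 6 12 _ (by norm_num) rfl, lift 2 4 _ four_ne_zero rfl,
    lift 3 6 _ (by norm_num) rfl, hg, hf2, hf6, hd]
  set d3 := expand 3 three_ne_zero d
  set d6 := expand 6 (by norm_num) d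
  set f4 := expand 4 four_ne_zero f
  set f12 := expand 12 (by norm_num) f
  rw [← hd, hd2]
  linear_combination expand 2 two_ne_zero c * d6 * d3 ^ 2 * d6 ^ 2 * f4 * f12 * hF +
    F * expand 2 two_ne_zero c * d6 ^ 3 * f4 * f12 * (d + c * d3) * hd

theorem coeff_pow_eq_schurOverpartitionTupleCount (t r n : ℕ) :
    coeff n ((Nat.Partition.genFun
      fun i _ => if i % (2 * t) ∈ schurResidues t then (2 : ℤ) else 0) ^ r) =
      schurOverpartitionTupleCount t r n := by
  classical
  rw [schurOverpartitionTupleCount, Nat.card_sigma]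
  simp only [Nat.card_pi]
  rw [show ∀ g : ℤ⟦X⟧, g ^ r = ∏ _j : Fin r, g by simp, coeff_prod]
  simp only [coeff_genFun_eq_schurOverpartitionCount]
  push_cast
  rw [Finset.univ_eq_attach, Finset.sum_attach (Finset.finAntidiagonal r n)
    fun s => ∏ j, (Nat.card (SchurOverpartition t (s j)) : ℤ)]
  refine Finset.sum_bij (fun l _ => (l : Fin r → ℕ)) ?_ ?_ ?_ ?_
  · intro l hl
    simpa [Finset.mem_finsuppAntidiag] using hl
  · intro a _ b _ h
    exact DFunLike.coe_injective h
  · intro s hs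
    exact ⟨Finsupp.equivFunOnFinite.symm s, by simpa [Finset.mem_finsuppAntidiag] using hs, rfl⟩
  · intro l _
    rfl

/-! ### Numbers that are not of the form `3 * x ^ 2 + y ^ 2` -/

/-- Otherwise `z = y/x` is a square root of `-3` modulo `p`, and `(z - 1)/2` has multiplicative
order 3, so `3 ∣ p - 1`, against `p ≡ 5` mod 6. -/
theorem dvd_and_dvd_of_dvd_three_mul_sq_add_sq {p : ℕ} (hp : p.Prime) (hp5 : p ≡ 5 [MOD 6])
    {x y : ℤ} (h : (p : ℤ) ∣ 3 * x ^ 2 + y ^ 2) : (p : ℤ) ∣ x ∧ (p : ℤ) ∣ y := by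
  have := Fact.mk hp
  have hmod : p % 6 = 5 := hp5
  have h2 : (2 : ZMod p) ≠ 0 := by
    intro h0
    have := (ZMod.natCast_eq_zero_iff 2 p).mp (by exact_mod_cast h0)
    have := Nat.le_of_dvd two_pos this
    omega
  have h12 : (12 : ZMod p) ≠ 0 := by
    intro h0
    have h1 := (ZMod.natCast_eq_zero_iff 12 p).mp (by exact_mod_cast h0)
    have h2 := Nat.le_of_dvd (by norm_num) h1
    have : p = 5 ∨ p = 11 := by omega
    rcases this with rfl | rfl <;> omega
  have h0 : (3 : ZMod p) * x ^ 2 + y ^ 2 = 0 := by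
    have := (ZMod.intCast_zmod_eq_zero_iff_dvd _ p).mpr h
    exact_mod_cast this
  have hx : (x : ZMod p) = 0 := by
    by_contra hx
    obtain ⟨z, hz⟩ : ∃ z : ZMod p, z ^ 2 = -3 := by
      refine ⟨y / x, ?_⟩
      field_simp
      linear_combination h0
    set a : ZMod p := (z - 1) / 2 with ha
    have hz' : z = 2 * a + 1 := by rw [ha]; field_simp; ring
    have ha2 : a ^ 2 + a + 1 = 0 := by
      have : (2 * 2 : ZMod p) * (a ^ 2 + a + 1) = 0 := by
        rw [hz'] at hz
        linear_combination hz
      simpa [h2] using this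
    have ha3 : a ^ 3 = 1 := by linear_combination (a - 1) * ha2
    have ha1 : a ≠ 1 := by
      intro h1
      rw [h1] at ha2
      exact h12 (by linear_combination 4 * ha2)
    have h3 : orderOf a = 3 := orderOf_eq_prime ha3 ha1
    have ha0 : a ≠ 0 := by
      rintro h
      rw [h] at ha3
      simp at ha3
    have := ZMod.orderOf_dvd_card_sub_one ha0
    rw [h3] at this
    omega
  have hy : (y : ZMod p) = 0 := by
    rw [hx] at h0
    simpa using h0
  exact ⟨(ZMod.intCast_zmod_eq_zero_iff_dvd _ p).mp hx,
    (ZMod.intCast_zmod_eq_zero_iff_dvd _ p).mp hy⟩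

/-- Descent: `p` divides both `x` and `y`, so `p^2` can be cancelled until only one factor `p`
remains. -/
theorem three_mul_sq_add_sq_ne {p : ℕ} (hp : p.Prime) (hp5 : p ≡ 5 [MOD 6]) (α : ℕ) {c : ℤ}
    (hc : ¬ (p : ℤ) ∣ c) (x y : ℤ) : 3 * x ^ 2 + y ^ 2 ≠ p ^ (2 * α + 1) * c := by
  have hp0 : (p : ℤ) ≠ 0 := by exact_mod_cast hp.ne_zero
  induction α generalizing x y with
  | zero =>
    intro h
    obtain ⟨⟨u, rfl⟩, v, rfl⟩ := dvd_and_dvd_of_dvd_three_mul_sq_add_sq hp hp5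
      (x := x) (y := y) ⟨c, by rw [h]; ring⟩
    refine hc ⟨3 * u ^ 2 + v ^ 2, mul_left_cancel₀ hp0 ?_⟩
    linear_combination -h
  | succ α ih =>
    intro h
    obtain ⟨⟨u, rfl⟩, v, rfl⟩ := dvd_and_dvd_of_dvd_three_mul_sq_add_sq hp hp5
      (x := x) (y := y) ⟨p ^ (2 * α + 2) * c, by rw [h]; ring⟩
    refine ih u v (mul_left_cancel₀ (pow_ne_zero 2 hp0) ?_)
    linear_combination h

/-- The number below is `≡ r` modulo `24`, and `p` divides it to an odd power. -/
theorem exists_eq_and_three_mul_sq_add_sq_ne {p : ℕ} (hp : p.Prime) (hp5 : p ≡ 5 [MOD 6])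
    (α n : ℕ) {i : ℕ} (hi1 : 1 ≤ i) (hip : i ≤ p - 1) (r : ℕ) :
    ∃ M, 24 * p ^ (2 * α + 2) * n + (24 * i + r * p) * p ^ (2 * α + 1) = 24 * M + r ∧
      ∀ x y : ℤ, 3 * x ^ 2 + y ^ 2 ≠ (24 * M + r : ℕ) := by
  have hmod : p % 6 = 5 := hp5
  -- This holds because `p` is coprime to 6; it makes `r * p ^ (2 * α + 2)` congruent to `r` modulo
  -- 24.
  have hsq : p ^ 2 % 24 = 1 := by
    have : p % 24 = 5 ∨ p % 24 = 11 ∨ p % 24 = 17 ∨ p % 24 = 23 := by omega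
    rcases this with h | h | h | h <;> simp [Nat.pow_mod, h]
  have hpow : p ^ (2 * α + 2) % 24 = 1 := by
    rw [show 2 * α + 2 = 2 * (α + 1) by ring, pow_mul, Nat.pow_mod, hsq]
    simp
  obtain ⟨k, hk⟩ : ∃ k, p ^ (2 * α + 2) = 24 * k + 1 := ⟨p ^ (2 * α + 2) / 24, by omega⟩
  have hM : 24 * p ^ (2 * α + 2) * n + (24 * i + r * p) * p ^ (2 * α + 1) =
      24 * (p ^ (2 * α + 2) * n + i * p ^ (2 * α + 1) + r * k) + r := by
    have : p * p ^ (2 * α + 1) = 24 * k + 1 := by rw [← hk]; ring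
    linear_combination r * this
  refine ⟨_, hM, fun x y h => ?_⟩
  rw [← hM] at h
  -- The cofactor of `p ^ (2 * α + 1)` is `24i` modulo `p`, and `p` divides neither 24 nor `i`, as
  -- `1 ≤ i < p`.
  have hc : ¬ (p : ℤ) ∣ 24 * p * n + 24 * i + r * p := by
    intro hd
    have h1 : (p : ℤ) ∣ 24 * i := by
      have := dvd_sub hd (Dvd.intro (24 * (n : ℤ) + r) rfl)
      rwa [show (24 * p * n + 24 * i + r * p - p * (24 * (n : ℤ) + r) : ℤ) = 24 * i by ring]
        at this
    have h2 : p ∣ 24 * i := by exact_mod_cast h1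
    rcases hp.dvd_mul.mp h2 with h3 | h3
    · have h4 : p ∣ 2 ^ 3 * 3 := by simpa using h3
      rcases hp.dvd_mul.mp h4 with h5 | h5
      · have := Nat.le_of_dvd two_pos (hp.dvd_of_dvd_pow h5)
        omega
      · have := Nat.le_of_dvd three_pos h5
        omega
    · have := Nat.le_of_dvd hi1 h3
      omega
  refine three_mul_sq_add_sq_ne hp hp5 α hc x y ?_
  rw [h]
  push_cast
  ring

end ThetaSeries

theorem theorem4p6 (p : ℕ) (hp : p.Prime) (hp5 : p ≡ 5 [MOD 6]) (α n i : ℕ)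
    (hi1 : 1 ≤ i) (hip : i ≤ p - 1) :
    schurOverpartitionCount 3
        (24 * p ^ (2 * α + 2) * n + (24 * i + 7 * p) * p ^ (2 * α + 1)) ≡ 0 [MOD 32] ∧
    ∀ m : ℕ,
      schurOverpartitionTupleCount 3 (16 * m + 1)
        (24 * p ^ (2 * α + 2) * n + (24 * i + 19 * p) * p ^ (2 * α + 1)) ≡ 0 [MOD 32] := by
  constructor
  · obtain ⟨M, hM, h⟩ := ThetaSeries.exists_eq_and_three_mul_sq_add_sq_ne hp hp5 α n hi1 hip 7
    have := ThetaSeries.thirtyTwo_dvd_coeff_seven ThetaSeries.isSchurSeries_genFun h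
    rw [ThetaSeries.coeff_genFun_eq_schurOverpartitionCount] at this
    rw [hM, Nat.modEq_zero_iff_dvd]
    exact_mod_cast this
  · intro m
    obtain ⟨M, hM, h⟩ := ThetaSeries.exists_eq_and_three_mul_sq_add_sq_ne hp hp5 α n hi1 hip 19
    have := ThetaSeries.thirtyTwo_dvd_coeff_pow_nineteen ThetaSeries.isSchurSeries_genFun m h
    rw [ThetaSeries.coeff_pow_eq_schurOverpartitionTupleCount] at this
    rw [hM, Nat.modEq_zero_iff_dvd]
    exact_mod_cast this
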